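/- Let $(w_n)_{n\ge 1}$ be non-negative reals with $w_1>0$ and $W_n=\sum_{i=1}^n w_i$. Let $(\mathtt T_n)_{n\ge1}$ be the weighted recursive tree with these weights: $\mathtt T_1$ consists of a root labelled $1$, and $\mathtt T_{n+1}$ is obtained from $\mathtt T_n$ by adding a vertex labelled $n+1$ whose parent is the vertex labelled $k$ with conditional probability $w_k/W_n$ given $\mathtt T_n$, for $1\le k\le n$. Let $\mathrm{ht}(\mathtt T_n)$ be the height of $\mathtt T_n$, the maximal distance of a vertex to the root. Let $(i_r)_{r\ge 0}$ be a strictly increasing sequence of integers with $i_0=1$, put $i_{-1}=0$ and, for $n\ge1$, let $t_n$ be the unique integer $r\ge0$ such that $i_{r-1}+1\le n\le i_r$. Assume that are given * a non-decreasing sequence $(T(n))_{n\ge2}$ of non-negative integers such that $T(n)<t_n$ for every $n\ge2$ and $T(n)\to\infty$ as $n\to\infty$; * a sequence $(\theta_r)_{r\ge1}$ of real numbers such that, for some $r_0\ge1$, $(\theta_r)_{r\ge r_0}$ is a non-decreasing sequence of non-negative numbers. Let $(Y_i)_{i\ge2}$ be independent random variables, $Y_i$ being Bernoulli with parameter $$p_i=\frac{e^{\theta_{t_i}}\frac{w_i}{W_i}}{1+(e^{\theta_{t_i}}-1)\frac{w_i}{W_i}},$$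 and, for given $n$, set $S_0=0$ and $S_r=\sum_{s=1}^r(X_s-1)$ for $r\ge1$, where $X_s=\sum_{i=i_{s-1}+1}^{\min(i_s,n)}Y_i$. Define, for $n\ge2$, $$E(n)=\mathbb E\left[\exp\left(\sum_{r=1}^{t_n-T(n)-1}(\theta_{T(n)+r+1}-\theta_{T(n)+r})(S_{T(n)+r}-S_{T(n)})\right)\mathbf 1_{\{S_{t_n}=S_{T(n)},\ \forall\, 0\le r<t_n-T(n),\ S_{T(n)+r}\le S_{T(n)}\}}\right],$$ $$\delta_1(n)=\sum_{i\ge i_{T(n)}+1}e^{2\theta_{t_i}}\frac{w_i^2}{W_i^2},$$ $$\delta_2(n)=\sum_{\ell\ge i_{T(n)}+1}e^{2\theta_{t_\ell}}\frac{w_\ell^2}{W_\ell^2}\exp\left(\sum_{r=T(n)+1}^{t_\ell-1}\theta_r-\sum_{i=i_{T(n)}+1}^{i_{t_\ell-1}}(e^{\theta_{t_i}}-1)\frac{w_i}{W_i}\right).$$ If $E(i_t)\neq0$ for every $t\ge1$ and $$\sum_{t\ge1}\delta_1(i_t)<\infty\qquad\text{and}\qquad\sum_{t\ge1}\frac{\delta_2(i_t)}{E(i_t)^2}<\infty,$$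 then almost surely, for all $n$ large enough, $\mathrm{ht}(\mathtt T_n)\ge t_n-T(n)-1$. -/

import Mathlib

open MeasureTheory ProbabilityTheory Filter
open scoped ENNReal

noncomputable section

namespace WRT

/-! ### Weighted recursive trees

A growing sequence of rooted trees `T_1, T_2, …`, where `T_n` has vertices `u_1, …, u_n` labelled
`1, …, n` and root `u_1`, is encoded by its parent labels: `K m` is the label of the parent of
`u_m`, for `m ≥ 2`. The values `K 0` and `K 1` play no role. -/

/-- Total weight `W_n = w_1 + ⋯ + w_n`; the value `w 0` plays no role. -/
def totalWeight (w : ℕ → ℝ) (n : ℕ) : ℝ := ∑ j ∈ Finset.Icc 1 n, w j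

/-- Height (distance to the root) of the vertex labelled `m` in the tree with parent labels `K`:
`0` for the root, and one more than the height of the parent for every other vertex. -/
def vertexHeight (K : ℕ → ℕ) (m : ℕ) : ℕ :=
  if _h : 1 ≤ K m ∧ K m < m then vertexHeight K (K m) + 1 else 0
termination_by m
decreasing_by exact _h.2

/-- Height of the tree `T_n`: the maximal height of its vertices `u_1, …, u_n`. -/
def treeHeight (K : ℕ → ℕ) (n : ℕ) : ℕ := (Finset.Icc 1 n).sup (vertexHeight K)

/-- The σ-algebra generated by the labelled tree `T_n`, that is, by `K_2, …, K_n`. -/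
abbrev treeSigma {Ω : Type*} (K : ℕ → Ω → ℕ) (n : ℕ) : MeasurableSpace Ω :=
  ⨆ j ∈ Finset.Icc 2 n, MeasurableSpace.comap (K j) ⊤

/-- `K` is the sequence of parent labels of a weighted recursive tree with weights `(w_n)_{n ≥ 1}`:
the parent of `u_{n+1}` is a vertex of `T_n`, and, conditionally on `T_n`, it is the
vertex labelled `k` with probability `w_k / W_n`. -/
structure IsWRT {Ω : Type*} [MeasurableSpace Ω] (P : Measure Ω) (w : ℕ → ℝ)
    (K : ℕ → Ω → ℕ) : Prop where
  measurable : ∀ n, 2 ≤ n → Measurable (K n)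
  parent_mem : ∀ n, 1 ≤ n → ∀ ω, K (n + 1) ω ∈ Finset.Icc 1 n
  condProb : ∀ n, 1 ≤ n → ∀ k ∈ Finset.Icc 1 n,
    P⟦{ω | K (n + 1) ω = k} | treeSigma K n⟧ =ᵐ[P] fun _ => w k / totalWeight w n

/-! ### The time change -/

/-- For a strictly increasing sequence `i` with `i 0 = 1` and `n ≥ 1`, this is `t_n`, the unique
`r ≥ 0` with `i_{r-1} + 1 ≤ n ≤ i_r`, where `i_{-1} = 0` (see `timeIndex_eq_iff`). -/
def timeIndex (i : ℕ → ℕ) (n : ℕ) : ℕ := sInf {r | n ≤ i r}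

theorem timeIndex_eq_iff {i : ℕ → ℕ} (hi : StrictMono i) {n : ℕ} (r : ℕ) :
    timeIndex i n = r ↔ n ≤ i r ∧ (1 ≤ r → i (r - 1) + 1 ≤ n) := by
  have hne : {r | n ≤ i r}.Nonempty := ⟨n, hi.id_le n⟩
  constructor
  · rintro rfl
    refine ⟨Nat.sInf_mem hne, fun h => ?_⟩
    by_contra hc
    have h2 : timeIndex i n ≤ timeIndex i n - 1 :=
      Nat.sInf_le (show n ≤ i (timeIndex i n - 1) by omega)
    omega
  · rintro ⟨h1, h2⟩
    refine le_antisymm (Nat.sInf_le h1) ?_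
    by_contra hc
    have h3 : n ≤ i (timeIndex i n) := Nat.sInf_mem hne
    have h4 : i (timeIndex i n) ≤ i (r - 1) := hi.monotone (by omega)
    have := h2 (by omega)
    omega

/-! ### The tilted random walk -/

/-- `p_j = e^{θ_{t_j}} (w_j / W_j) / (1 + (e^{θ_{t_j}} - 1) w_j / W_j)`. -/
def tiltedProb (w : ℕ → ℝ) (i : ℕ → ℕ) (θ : ℕ → ℝ) (j : ℕ) : ℝ :=
  (Real.exp (θ (timeIndex i j)) * (w j / totalWeight w j)) /
    (1 + (Real.exp (θ (timeIndex i j)) - 1) * (w j / totalWeight w j))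

theorem tiltedProb_mem_Icc {w : ℕ → ℝ} (hw : ∀ n, 1 ≤ n → 0 ≤ w n) (i : ℕ → ℕ) (θ : ℕ → ℝ)
    {j : ℕ} (hj : 1 ≤ j) : tiltedProb w i θ j ∈ Set.Icc (0 : ℝ) 1 := by
  have hW : w j ≤ totalWeight w j :=
    Finset.single_le_sum (f := w) (fun k hk => hw k (Finset.mem_Icc.1 hk).1)
      (Finset.mem_Icc.2 ⟨hj, le_rfl⟩)
  have hq0 : 0 ≤ w j / totalWeight w j := div_nonneg (hw j hj) ((hw j hj).trans hW)
  have hq1 : w j / totalWeight w j ≤ 1 := div_le_one_of_le₀ hW ((hw j hj).trans hW)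
  have he := mul_nonneg (Real.exp_pos (θ (timeIndex i j))).le hq0
  unfold tiltedProb
  exact ⟨div_nonneg he (by linarith), div_le_one_of_le₀ (by linarith) (by linarith)⟩

/-- The law of a sequence `(Y_j)` of independent Bernoulli(`p_j`) random variables. The projection
onto `[0, 1]` leaves `p_j` unchanged for `j ≥ 1`, by `tiltedProb_mem_Icc`; the coordinates `Y_0`
and `Y_1` are not used below. -/
def tiltedLaw (w : ℕ → ℝ) (i : ℕ → ℕ) (θ : ℕ → ℝ) : Measure (ℕ → ℕ) :=
  Measure.infinitePi fun j =>
    bernoulliMeasure 1 0 (Set.projIcc (0 : ℝ) 1 zero_le_one (tiltedProb w i θ j))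

/-- `S_r = ∑_{s=1}^r (X_s - 1)`, where `X_s = ∑_{j = i_{s-1}+1}^{min(i_s, n)} Y_j`. -/
def walk (i : ℕ → ℕ) (n : ℕ) (Y : ℕ → ℕ) (r : ℕ) : ℤ :=
  ∑ s ∈ Finset.Icc 1 r, ((∑ j ∈ Finset.Ioc (i (s - 1)) (min (i s) n), (Y j : ℤ)) - 1)

/-! ### The quantities `E(n)`, `δ₁(n)` and `δ₂(n)` -/

/-- `E(n)`: the expectation of
`exp (∑_{r=1}^{t_n-T(n)-1} (θ_{T(n)+r+1} - θ_{T(n)+r}) (S_{T(n)+r} - S_{T(n)}))`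
on the event that `S_{t_n} = S_{T(n)}` and `S_{T(n)+r} ≤ S_{T(n)}` for all `r < t_n - T(n)`. -/
def E (w : ℕ → ℝ) (i : ℕ → ℕ) (θ : ℕ → ℝ) (T : ℕ → ℕ) (n : ℕ) : ℝ :=
  ∫ Y, Set.indicator
    {Y : ℕ → ℕ | walk i n Y (timeIndex i n) = walk i n Y (T n) ∧
      ∀ r < timeIndex i n - T n, walk i n Y (T n + r) ≤ walk i n Y (T n)}
    (fun Y => Real.exp (∑ r ∈ Finset.Icc 1 (timeIndex i n - T n - 1),
      (θ (T n + r + 1) - θ (T n + r)) * ((walk i n Y (T n + r) - walk i n Y (T n) : ℤ) : ℝ)))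
    Y ∂(tiltedLaw w i θ)

/-- `δ₁(n) = ∑_{ℓ ≥ i_{T(n)}+1} e^{2θ_{t_ℓ}} w_ℓ² / W_ℓ²`, an element of `[0, ∞]`. -/
def delta₁ (w : ℕ → ℝ) (i : ℕ → ℕ) (θ : ℕ → ℝ) (T : ℕ → ℕ) (n : ℕ) : ℝ≥0∞ :=
  ∑' ℓ : {ℓ : ℕ // i (T n) + 1 ≤ ℓ},
    ENNReal.ofReal (Real.exp (2 * θ (timeIndex i ℓ)) * (w ℓ ^ 2 / totalWeight w ℓ ^ 2))

/-- `δ₂(n) = ∑_{ℓ ≥ i_{T(n)}+1} e^{2θ_{t_ℓ}} (w_ℓ² / W_ℓ²) exp (∑_{r=T(n)+1}^{t_ℓ-1} θ_r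
- ∑_{j=i_{T(n)}+1}^{i_{t_ℓ-1}} (e^{θ_{t_j}} - 1) w_j / W_j)`, an element of `[0, ∞]`. -/
def delta₂ (w : ℕ → ℝ) (i : ℕ → ℕ) (θ : ℕ → ℝ) (T : ℕ → ℕ) (n : ℕ) : ℝ≥0∞ :=
  ∑' ℓ : {ℓ : ℕ // i (T n) + 1 ≤ ℓ},
    ENNReal.ofReal (Real.exp (2 * θ (timeIndex i ℓ)) * (w ℓ ^ 2 / totalWeight w ℓ ^ 2) *
      Real.exp (∑ r ∈ Finset.Icc (T n + 1) (timeIndex i ℓ - 1), θ r -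
        ∑ j ∈ Finset.Icc (i (T n) + 1) (i (timeIndex i ℓ - 1)),
          (Real.exp (θ (timeIndex i j)) - 1) * (w j / totalWeight w j)))

end WRT

end

/-!
The proof is a second moment argument. Pick a vertex of `T_n` with probability proportional to its
weight: the labels on its ancestral line are then independent, `j` being present with probability
`w_j / W_j`. Give weight to the vertices of `T_{i_t}` whose ancestral line in `(i_T, i_t]`, where
`T = T(i_t)`, is an excursion: it has exactly `t - T` elements, and at most `r` of them up to
`i_{T+r}`. If the total weight of these vertices is non-zero, then the height is at least `t - T`.

Tilting the probability of the label `j` by `e^{θ_{t_j}}` turns the mean of this weight into an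
explicit positive constant times `E(i_t)`. For the second moment, decompose according to the label
`l` of the last common ancestor of two vertices. As `θ` is non-decreasing, being an excursion
bounds the tilt from below both on the whole line and on its part above `l`; this bounds the
variance by the square of the constant times `e^{δ₁/2} δ₂`. Chebyshev's inequality and the
Borel–Cantelli lemma give the height bound along the times `i_t`, and the other times follow since
the height is non-decreasing.
-/

namespace WRT

open Finset

/-! ### Random subsets with independent memberships -/

section RandomSubset

variable {α : Type*} [DecidableEq α]

/-- Expectation of `F s`, where the random subset `s` of `I` contains each `j ∈ I` independently
with probability `q j`. -/
noncomputable def subsetAvg (q : α → ℝ) (I : Finset α) (F : Finset α → ℝ) : ℝ :=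
  ∑ s ∈ I.powerset, (∏ j ∈ s, q j) * (∏ j ∈ I \ s, (1 - q j)) * F s

@[simp]
theorem subsetAvg_empty (q : α → ℝ) (F : Finset α → ℝ) : subsetAvg q ∅ F = F ∅ := by
  simp [subsetAvg]

theorem subsetAvg_add (q : α → ℝ) (I : Finset α) (F G : Finset α → ℝ) :
    subsetAvg q I (fun s => F s + G s) = subsetAvg q I F + subsetAvg q I G := by
  simp [subsetAvg, mul_add, sum_add_distrib]

theorem subsetAvg_const_mul (q : α → ℝ) (I : Finset α) (c : ℝ) (F : Finset α → ℝ) :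
    subsetAvg q I (fun s => c * F s) = c * subsetAvg q I F := by
  simp only [subsetAvg, mul_sum, mul_left_comm c]

theorem subsetAvg_const (q : α → ℝ) (I : Finset α) (c : ℝ) : subsetAvg q I (fun _ => c) = c := by
  rw [subsetAvg, ← sum_mul, ← prod_add q (fun j => 1 - q j) I]
  simp

theorem subsetAvg_congr_prob {p q : α → ℝ} {I : Finset α} (h : ∀ j ∈ I, p j = q j)
    (F : Finset α → ℝ) : subsetAvg p I F = subsetAvg q I F := by
  refine sum_congr rfl fun s hs => ?_
  rw [prod_congr rfl fun j hj => h j (mem_powerset.1 hs hj),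
    prod_congr rfl fun j hj => congrArg (1 - ·) (h j (mem_sdiff.1 hj).1)]

theorem subsetAvg_insert (q : α → ℝ) {I : Finset α} {a : α} (ha : a ∉ I) (F : Finset α → ℝ) :
    subsetAvg q (insert a I) F =
      subsetAvg q I (fun s => (1 - q a) * F s + q a * F (insert a s)) := by
  rw [subsetAvg_add, subsetAvg_const_mul, subsetAvg_const_mul]
  simp only [subsetAvg]
  rw [sum_powerset_insert ha, mul_sum, mul_sum]
  congr 1 <;> refine sum_congr rfl fun s hs => ?_
  · have has : a ∉ s := fun h => ha (mem_powerset.1 hs h)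
    rw [insert_sdiff_of_notMem _ has, prod_insert (by simp [ha])]
    ring
  · have has : a ∉ s := fun h => ha (mem_powerset.1 hs h)
    rw [insert_sdiff_insert, sdiff_insert_of_notMem ha, prod_insert has]
    ring

theorem subsetAvg_mono {q : α → ℝ} {I : Finset α} (hq : ∀ j ∈ I, q j ∈ Set.Icc (0 : ℝ) 1)
    {F G : Finset α → ℝ} (h : ∀ s ⊆ I, F s ≤ G s) : subsetAvg q I F ≤ subsetAvg q I G := by
  refine sum_le_sum fun s hs => ?_
  rw [mem_powerset] at hs
  refine mul_le_mul_of_nonneg_left (h s hs) (mul_nonneg ?_ ?_)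
  · exact prod_nonneg fun j hj => (hq j (hs hj)).1
  · exact prod_nonneg fun j hj => sub_nonneg.2 (hq j (mem_sdiff.1 hj).1).2

theorem subsetAvg_nonneg {q : α → ℝ} {I : Finset α} (hq : ∀ j ∈ I, q j ∈ Set.Icc (0 : ℝ) 1)
    {F : Finset α → ℝ} (h : ∀ s ⊆ I, 0 ≤ F s) : 0 ≤ subsetAvg q I F :=
  (subsetAvg_const q I 0).symm.trans_le (subsetAvg_mono hq h)

theorem subsetAvg_le_of_le {q : α → ℝ} {I : Finset α} (hq : ∀ j ∈ I, q j ∈ Set.Icc (0 : ℝ) 1)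
    {F : Finset α → ℝ} {c : ℝ} (h : ∀ s ⊆ I, F s ≤ c) : subsetAvg q I F ≤ c :=
  (subsetAvg_mono hq h).trans_eq (subsetAvg_const q I c)

theorem subsetAvg_eq_prod_mul_subsetAvg_tilted {q ψ : α → ℝ} {I : Finset α}
    (hpos : ∀ j ∈ I, 0 < 1 + (Real.exp (ψ j) - 1) * q j) (F : Finset α → ℝ) :
    subsetAvg q I F = (∏ j ∈ I, (1 + (Real.exp (ψ j) - 1) * q j)) *
      subsetAvg (fun j => Real.exp (ψ j) * q j / (1 + (Real.exp (ψ j) - 1) * q j)) I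
        (fun s => Real.exp (-∑ j ∈ s, ψ j) * F s) := by
  set z : α → ℝ := fun j => 1 + (Real.exp (ψ j) - 1) * q j
  simp only [subsetAvg, mul_sum]
  refine sum_congr rfl fun s hs => ?_
  rw [mem_powerset] at hs
  have hmem : ∏ j ∈ s, q j =
      (∏ j ∈ s, z j) * (∏ j ∈ s, Real.exp (ψ j) * q j / z j) * Real.exp (-∑ j ∈ s, ψ j) := by
    rw [← sum_neg_distrib, Real.exp_sum, ← prod_mul_distrib, ← prod_mul_distrib]
    refine prod_congr rfl fun j hj => ?_
    rw [mul_div_cancel₀ _ (hpos j (hs hj)).ne', mul_right_comm, ← Real.exp_add, add_neg_cancel,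
      Real.exp_zero, one_mul]
  have hnotMem : ∏ j ∈ I \ s, (1 - q j) =
      (∏ j ∈ I \ s, z j) * ∏ j ∈ I \ s, (1 - Real.exp (ψ j) * q j / z j) := by
    rw [← prod_mul_distrib]
    refine prod_congr rfl fun j hj => ?_
    rw [mul_sub, mul_div_cancel₀ _ (hpos j (mem_sdiff.1 hj).1).ne']
    ring
  rw [hmem, hnotMem, ← prod_sdiff hs]
  ring

theorem setOf_filter_eq_one_eq_pi {I s : Finset α} (hs : s ⊆ I) :
    {Y : α → ℕ | {j ∈ I | Y j = 1} = s} =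
      Set.pi (I : Set α) (fun j => if j ∈ s then {1} else {1}ᶜ) := by
  ext Y
  simp only [Set.mem_ofPred_eq, Set.mem_pi, mem_coe, Finset.ext_iff, mem_filter]
  refine ⟨fun h j hj => ?_, fun h j => ?_⟩
  · split_ifs <;> grind
  · have := h j
    split_ifs at this <;> grind

theorem infinitePi_bernoulliMeasure_real_filter_eq_one (p : α → unitInterval)
    {I s : Finset α} (hs : s ⊆ I) :
    (Measure.infinitePi fun j => bernoulliMeasure (1 : ℕ) 0 (p j)).real
        {Y : α → ℕ | {j ∈ I | Y j = 1} = s} =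
      (∏ j ∈ s, (p j : ℝ)) * ∏ j ∈ I \ s, (1 - (p j : ℝ)) := by
  rw [setOf_filter_eq_one_eq_pi hs, measureReal_def,
    Measure.infinitePi_pi _ fun j _ => MeasurableSet.of_discrete, ENNReal.toReal_prod,
    ← prod_sdiff hs, mul_comm]
  congr 1 <;> refine prod_congr rfl fun j hj => ?_
  · rw [if_pos hj, ← measureReal_def]
    exact bernoulliMeasure_real_apply_of_mem_of_notMem _ MeasurableSet.of_discrete (by simp)
      (by simp)
  · rw [if_neg (mem_sdiff.1 hj).2, ← measureReal_def]
    exact bernoulliMeasure_real_apply_of_notMem_of_mem _ MeasurableSet.of_discrete (by simp)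
      (by simp)

theorem integral_filter_eq_one_infinitePi_bernoulliMeasure (p : α → unitInterval)
    (I : Finset α) (F : Finset α → ℝ) :
    ∫ Y, F {j ∈ I | Y j = 1} ∂(Measure.infinitePi fun j => bernoulliMeasure (1 : ℕ) 0 (p j)) =
      subsetAvg (fun j => (p j : ℝ)) I F := by
  have hmeas : ∀ s ∈ I.powerset, MeasurableSet {Y : α → ℕ | {j ∈ I | Y j = 1} = s} := by
    intro s hs
    rw [setOf_filter_eq_one_eq_pi (mem_powerset.1 hs)]
    exact MeasurableSet.pi I.countable_toSet fun j _ => MeasurableSet.of_discrete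
  have hsum : ∀ Y : α → ℕ, F {j ∈ I | Y j = 1} = ∑ s ∈ I.powerset,
      Set.indicator {Y : α → ℕ | {j ∈ I | Y j = 1} = s} (fun _ => F s) Y := by
    intro Y
    rw [sum_eq_single_of_mem {j ∈ I | Y j = 1} (mem_powerset.2 (filter_subset _ _))
      fun s _ hne => Set.indicator_of_notMem (fun h => hne h.symm) _]
    simp
  simp_rw [hsum]
  rw [integral_finsetSum _ fun s hs => (integrable_const _).indicator (hmeas s hs), subsetAvg]
  refine sum_congr rfl fun s hs => ?_
  rw [integral_indicator_const _ (hmeas s hs),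
    infinitePi_bernoulliMeasure_real_filter_eq_one p (mem_powerset.1 hs), smul_eq_mul]

end RandomSubset

theorem ae_eq_zero_or_one_infinitePi_bernoulliMeasure {α : Type*} [Countable α]
    (p : α → unitInterval) :
    ∀ᵐ Y ∂(Measure.infinitePi fun j => bernoulliMeasure (1 : ℕ) 0 (p j)),
      ∀ j, Y j = 0 ∨ Y j = 1 := by
  refine ae_all_iff.2 fun j => (measurePreserving_eval_infinitePi
    (fun j => bernoulliMeasure (1 : ℕ) 0 (p j)) j).quasiMeasurePreserving.ae
    (p := fun y => y = 0 ∨ y = 1) ?_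
  rw [ae_iff]
  exact bernoulliMeasure_apply_of_notMem_of_notMem _ MeasurableSet.of_discrete (by simp) (by simp)

/-! ### Ancestral lines -/

/-- The labels of the vertices other than the root on the path from the root to the vertex
labelled `k`. -/
def ancestors (K : ℕ → ℕ) (k : ℕ) : Finset ℕ :=
  if _h : 1 ≤ K k ∧ K k < k then insert k (ancestors K (K k)) else ∅
termination_by k
decreasing_by exact _h.2

theorem ancestors_eq_insert {K : ℕ → ℕ} {k : ℕ} (h : 1 ≤ K k ∧ K k < k) :
    ancestors K k = insert k (ancestors K (K k)) := by
  rw [ancestors, dif_pos h]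

theorem ancestors_subset_Ioc (K : ℕ → ℕ) (k : ℕ) : ancestors K k ⊆ Ioc 1 k := by
  induction k using Nat.strong_induction_on with
  | _ k ih =>
    rw [ancestors]
    split_ifs with h
    · exact insert_subset (mem_Ioc.2 ⟨by lia, le_rfl⟩)
        ((ih _ h.2).trans (Ioc_subset_Ioc_right h.2.le))
    · exact empty_subset _

theorem ancestors_one (K : ℕ → ℕ) : ancestors K 1 = ∅ := by
  simpa using ancestors_subset_Ioc K 1

theorem card_ancestors (K : ℕ → ℕ) (k : ℕ) : #(ancestors K k) = vertexHeight K k := by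
  induction k using Nat.strong_induction_on with
  | _ k ih =>
    rw [ancestors, vertexHeight]
    split_ifs with h
    · have hk : k ∉ ancestors K (K k) := fun hk =>
        h.2.not_ge (mem_Ioc.1 (ancestors_subset_Ioc K _ hk)).2
      rw [card_insert_of_notMem hk, ih _ h.2]
    · exact card_empty

theorem totalWeight_succ (w : ℕ → ℝ) (n : ℕ) :
    totalWeight w (n + 1) = totalWeight w n + w (n + 1) := by
  simp [totalWeight, sum_Icc_succ_top]

theorem totalWeight_pos {w : ℕ → ℝ} (hw : ∀ n, 1 ≤ n → 0 ≤ w n) (hw1 : 0 < w 1) {n : ℕ}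
    (hn : 1 ≤ n) : 0 < totalWeight w n :=
  sum_pos' (fun k hk => hw k (mem_Icc.1 hk).1) ⟨1, mem_Icc.2 ⟨le_rfl, hn⟩, hw1⟩

/-- `w_j / W_j`, the probability that the vertex labelled `j` is an ancestor of a vertex of `T_n`,
`n ≥ j`, picked with probability proportional to its weight. -/
noncomputable def weightRatio (w : ℕ → ℝ) (j : ℕ) : ℝ := w j / totalWeight w j

theorem weightRatio_mem_Icc {w : ℕ → ℝ} (hw : ∀ n, 1 ≤ n → 0 ≤ w n) {j : ℕ} (hj : 1 ≤ j) :
    weightRatio w j ∈ Set.Icc (0 : ℝ) 1 := by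
  have hW : w j ≤ totalWeight w j :=
    single_le_sum (f := w) (fun k hk => hw k (mem_Icc.1 hk).1) (mem_Icc.2 ⟨hj, le_rfl⟩)
  exact ⟨div_nonneg (hw j hj) ((hw j hj).trans hW), div_le_one_of_le₀ hW ((hw j hj).trans hW)⟩

theorem one_sub_weightRatio_succ {w : ℕ → ℝ} {n : ℕ} (hW : totalWeight w (n + 1) ≠ 0) :
    1 - weightRatio w (n + 1) = totalWeight w n / totalWeight w (n + 1) := by
  rw [weightRatio, one_sub_div hW, totalWeight_succ, add_sub_cancel_right]

/-- Average of `f` over the ancestral lines of the vertices of `T_n`, each vertex being counted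
proportionally to its weight. -/
noncomputable def vertexAvg (w : ℕ → ℝ) (K : ℕ → ℕ) (n : ℕ) (f : Finset ℕ → ℝ) : ℝ :=
  ∑ k ∈ Icc 1 n, w k / totalWeight w n * f (ancestors K k)

theorem vertexAvg_congr {w : ℕ → ℝ} {K : ℕ → ℕ} {n : ℕ} {f g : Finset ℕ → ℝ}
    (h : ∀ s ⊆ Ioc 1 n, f s = g s) : vertexAvg w K n f = vertexAvg w K n g := by
  refine sum_congr rfl fun k hk => ?_
  rw [h _ ((ancestors_subset_Ioc K k).trans (Ioc_subset_Ioc_right (mem_Icc.1 hk).2))]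

theorem vertexAvg_const {w : ℕ → ℝ} {n : ℕ} (hW : totalWeight w n ≠ 0) (K : ℕ → ℕ) (c : ℝ) :
    vertexAvg w K n (fun _ => c) = c := by
  rw [vertexAvg, ← sum_mul, ← sum_div, ← totalWeight, div_self hW, one_mul]

theorem vertexAvg_linear_combination (w : ℕ → ℝ) (K : ℕ → ℕ) (n : ℕ) (a b : ℝ)
    (f g : Finset ℕ → ℝ) :
    vertexAvg w K n (fun s => a * f s + b * g s) =
      a * vertexAvg w K n f + b * vertexAvg w K n g := by
  simp only [vertexAvg, mul_sum, ← sum_add_distrib]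
  exact sum_congr rfl fun k _ => by ring

theorem vertexAvg_succ {w : ℕ → ℝ} {K : ℕ → ℕ} {n : ℕ} (hW : totalWeight w n ≠ 0)
    (hW' : totalWeight w (n + 1) ≠ 0) (hK : K (n + 1) ∈ Icc 1 n) (f : Finset ℕ → ℝ) :
    vertexAvg w K (n + 1) f = (1 - weightRatio w (n + 1)) * vertexAvg w K n f +
      weightRatio w (n + 1) * f (insert (n + 1) (ancestors K (K (n + 1)))) := by
  rw [mem_Icc] at hK
  rw [vertexAvg, sum_Icc_succ_top (by lia), ancestors_eq_insert (by lia),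
    one_sub_weightRatio_succ hW', vertexAvg, mul_sum, weightRatio]
  congr 1
  refine sum_congr rfl fun k _ => ?_
  field_simp

/-! ### Moments of weighted averages over the vertices -/

theorem inter_Ioc_add_one {m n : ℕ} {s : Finset ℕ} (hmn : m ≤ n) (hs : s ⊆ Ioc 1 n) :
    s ∩ Ioc m (n + 1) = s ∩ Ioc m n := by
  rw [← insert_Ioc_right_eq_Ioc_add_one hmn,
    inter_insert_of_notMem fun h => by simpa using hs h]

theorem insert_inter_Ioc_add_one {m n : ℕ} (hmn : m ≤ n) (s : Finset ℕ) :
    insert (n + 1) s ∩ Ioc m (n + 1) = insert (n + 1) (s ∩ Ioc m n) := by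
  rw [← insert_Ioc_right_eq_Ioc_add_one hmn, ← insert_inter_distrib]

theorem subsetAvg_Ioc_add_one (q : ℕ → ℝ) {m n : ℕ} (hmn : m ≤ n) (F : Finset ℕ → ℝ) :
    subsetAvg q (Ioc m (n + 1)) F = subsetAvg q (Ioc m n) (fun s =>
      (1 - q (n + 1)) * F s + q (n + 1) * F (insert (n + 1) s)) := by
  rw [← insert_Ioc_right_eq_Ioc_add_one hmn, subsetAvg_insert q (by simp)]

/-- Bound for the variance of the average of `f` over the vertices of `T_n`. The `l`-th term
accounts for pairs of vertices whose last common ancestor has label `l`: they share their ancestral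
line up to `l`, and the parts beyond `l` are treated as independent. -/
noncomputable def splitSum (w : ℕ → ℝ) (m n : ℕ) (f : Finset ℕ → ℝ) : ℝ :=
  ∑ l ∈ Ioc m n, weightRatio w l ^ 2 * subsetAvg (weightRatio w) (Ioc m (l - 1)) (fun a =>
    subsetAvg (weightRatio w) (Ioc l n) (fun s => f (insert l a ∪ s)) ^ 2)

theorem splitSum_add_one (w : ℕ → ℝ) {m n : ℕ} (hmn : m ≤ n) (f : Finset ℕ → ℝ) :
    splitSum w m (n + 1) f =
      splitSum w m n (fun s =>
        (1 - weightRatio w (n + 1)) * f s + weightRatio w (n + 1) * f (insert (n + 1) s)) +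
      weightRatio w (n + 1) ^ 2 *
        subsetAvg (weightRatio w) (Ioc m n) (fun a => f (insert (n + 1) a) ^ 2) := by
  rw [splitSum, ← insert_Ioc_right_eq_Ioc_add_one hmn, sum_insert (by simp), add_comm]
  congr 1
  · refine sum_congr rfl fun l hl => ?_
    simp only [subsetAvg_Ioc_add_one _ (mem_Ioc.1 hl).2, union_insert]
  · simp

theorem measurable_parent_treeSigma {Ω : Type*} (K : ℕ → Ω → ℕ) {n j : ℕ} (hj : j ∈ Icc 2 n) :
    Measurable[treeSigma K n] (K j) :=
  measurable_iff_comap_le.2 (le_iSup₂_of_le j hj le_rfl)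

section Moments

variable {Ω : Type*} [mΩ : MeasurableSpace Ω] {P : Measure Ω} {w : ℕ → ℝ} {K : ℕ → Ω → ℕ}

theorem IsWRT.treeSigma_le (hK : IsWRT P w K) (n : ℕ) : treeSigma K n ≤ mΩ :=
  iSup₂_le fun j hj => measurable_iff_comap_le.1 (hK.measurable j (mem_Icc.1 hj).1)

theorem IsWRT.apply_ancestors_parent (hK : IsWRT P w K) {n : ℕ} (hn : 1 ≤ n)
    (f : Finset ℕ → ℝ) (ω : Ω) :
    f (ancestors (K · ω) (K (n + 1) ω)) = ∑ k ∈ Icc 1 n,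
      f (ancestors (K · ω) k) * {ω | K (n + 1) ω = k}.indicator (fun _ => (1 : ℝ)) ω := by
  rw [sum_eq_single_of_mem _ (hK.parent_mem n hn ω) fun k _ hk => ?_]
  · simp
  · rw [Set.indicator_of_notMem (fun h => hk h.symm), mul_zero]

theorem IsWRT.measurable_ancestors (hK : IsWRT P w K) {n k : ℕ} (hk : k ∈ Icc 1 n)
    (f : Finset ℕ → ℝ) : Measurable[treeSigma K n] fun ω => f (ancestors (K · ω) k) := by
  induction k using Nat.strong_induction_on generalizing f with
  | _ k ih =>
    rw [mem_Icc] at hk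
    obtain rfl | ⟨k, hk1, rfl⟩ : k = 1 ∨ ∃ l, 1 ≤ l ∧ k = l + 1 := by
      rcases hk.1.eq_or_lt with h | h
      · exact .inl h.symm
      · exact .inr ⟨k - 1, by lia, by lia⟩
    · simp only [ancestors_one]
      exact measurable_const
    · have hparent : ∀ ω, ancestors (K · ω) (k + 1) =
          insert (k + 1) (ancestors (K · ω) (K (k + 1) ω)) := fun ω =>
        ancestors_eq_insert (by have := mem_Icc.1 (hK.parent_mem k hk1 ω); lia)
      simp_rw [hparent, hK.apply_ancestors_parent hk1 fun s => f (insert (k + 1) s)]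
      refine Finset.measurable_fun_sum _ fun j hj => ?_
      rw [mem_Icc] at hj
      exact (ih j (by lia) (mem_Icc.2 (by lia)) fun s => f (insert (k + 1) s)).mul
        (measurable_const.indicator (measurable_parent_treeSigma K (mem_Icc.2 (by lia))
          (MeasurableSet.singleton j)))

theorem IsWRT.measurable_vertexAvg (hK : IsWRT P w K) (n : ℕ) (f : Finset ℕ → ℝ) :
    Measurable[treeSigma K n] fun ω => vertexAvg w (K · ω) n f :=
  Finset.measurable_fun_sum _ fun _ hk => (hK.measurable_ancestors hk f).const_mul _

theorem IsWRT.measurableSet_parent_eq (hK : IsWRT P w K) {n : ℕ} (hn : 1 ≤ n) (k : ℕ) :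
    MeasurableSet {ω | K (n + 1) ω = k} :=
  hK.measurable (n + 1) (by lia) (MeasurableSet.singleton k)

section FiniteMeasure

variable [IsFiniteMeasure P]

theorem IsWRT.memLp_ancestors (hK : IsWRT P w K) {k : ℕ} (hk : 1 ≤ k) (f : Finset ℕ → ℝ)
    (p : ℝ≥0∞) : MemLp (fun ω => f (ancestors (K · ω) k)) p P := by
  refine MemLp.of_bound ((hK.measurable_ancestors (mem_Icc.2 ⟨hk, le_rfl⟩) f).mono
    (hK.treeSigma_le k) le_rfl).aestronglyMeasurable (∑ s ∈ (Ioc 1 k).powerset, |f s|)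
    (ae_of_all _ fun ω => ?_)
  exact single_le_sum (f := fun s => |f s|) (fun _ _ => abs_nonneg _)
    (mem_powerset.2 (ancestors_subset_Ioc _ k))

theorem IsWRT.memLp_vertexAvg (hK : IsWRT P w K) (n : ℕ) (f : Finset ℕ → ℝ) (p : ℝ≥0∞) :
    MemLp (fun ω => vertexAvg w (K · ω) n f) p P :=
  memLp_finsetSum _ fun _ hk => (hK.memLp_ancestors (mem_Icc.1 hk).1 f p).const_mul _

theorem IsWRT.memLp_ancestors_mul_indicator (hK : IsWRT P w K) {n : ℕ} (hn : 1 ≤ n) {k : ℕ}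
    (hk : 1 ≤ k) (f : Finset ℕ → ℝ) (p : ℝ≥0∞) :
    MemLp (fun ω => f (ancestors (K · ω) k) *
      {ω | K (n + 1) ω = k}.indicator (fun _ => (1 : ℝ)) ω) p P := by
  simp only [← Set.indicator_mul_right {ω | K (n + 1) ω = k}
    (fun ω => f (ancestors (K · ω) k)), mul_one]
  exact (hK.memLp_ancestors hk f p).indicator (hK.measurableSet_parent_eq hn k)

theorem IsWRT.memLp_ancestors_parent (hK : IsWRT P w K) {n : ℕ} (hn : 1 ≤ n)
    (f : Finset ℕ → ℝ) (p : ℝ≥0∞) :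
    MemLp (fun ω => f (ancestors (K · ω) (K (n + 1) ω))) p P := by
  simp_rw [hK.apply_ancestors_parent hn f]
  exact memLp_finsetSum _ fun k hk => hK.memLp_ancestors_mul_indicator hn (mem_Icc.1 hk).1 f p

theorem IsWRT.condExp_ancestors_parent (hK : IsWRT P w K) {n : ℕ} (hn : 1 ≤ n)
    (f : Finset ℕ → ℝ) :
    P[fun ω => f (ancestors (K · ω) (K (n + 1) ω)) | treeSigma K n] =ᵐ[P]
      fun ω => vertexAvg w (K · ω) n f := by
  have hterm : ∀ k ∈ Icc 1 n, P[fun ω => f (ancestors (K · ω) k) *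
      {ω | K (n + 1) ω = k}.indicator (fun _ => (1 : ℝ)) ω | treeSigma K n] =ᵐ[P]
      fun ω => w k / totalWeight w n * f (ancestors (K · ω) k) := by
    intro k hk
    have hpull := condExp_mul_of_stronglyMeasurable_left (m := treeSigma K n) (μ := P)
      (hK.measurable_ancestors hk f).stronglyMeasurable
      ((hK.memLp_ancestors_mul_indicator hn (mem_Icc.1 hk).1 f 1).integrable le_rfl)
      ((integrable_const (1 : ℝ)).indicator (hK.measurableSet_parent_eq hn k))
    filter_upwards [hpull, hK.condProb n hn k hk] with ω hω hprob
    exact hω.trans (by rw [Pi.mul_apply, hprob, mul_comm])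
  have hsum : (fun ω => f (ancestors (K · ω) (K (n + 1) ω))) = ∑ k ∈ Icc 1 n, fun ω =>
      f (ancestors (K · ω) k) * {ω | K (n + 1) ω = k}.indicator (fun _ => (1 : ℝ)) ω :=
    funext fun ω => by rw [Finset.sum_apply, hK.apply_ancestors_parent hn f]
  rw [hsum]
  refine (condExp_finsetSum (fun k hk =>
    (hK.memLp_ancestors_mul_indicator hn (mem_Icc.1 hk).1 f 1).integrable le_rfl) _).trans ?_
  filter_upwards [(eventually_all_finset (Icc 1 n)).2 hterm] with ω hω
  rw [Finset.sum_apply, vertexAvg]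
  exact sum_congr rfl hω

theorem IsWRT.integral_mul_ancestors_parent (hK : IsWRT P w K) {n : ℕ} (hn : 1 ≤ n)
    (f : Finset ℕ → ℝ) {H : Ω → ℝ} (hH : Measurable[treeSigma K n] H) (hH2 : MemLp H 2 P) :
    ∫ ω, H ω * f (ancestors (K · ω) (K (n + 1) ω)) ∂P =
      ∫ ω, H ω * vertexAvg w (K · ω) n f ∂P := by
  have hpull := condExp_mul_of_stronglyMeasurable_left (m := treeSigma K n) (μ := P)
    hH.stronglyMeasurable (hH2.integrable_mul (hK.memLp_ancestors_parent hn f 2))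
    ((hK.memLp_ancestors_parent hn f 1).integrable le_rfl)
  refine (integral_condExp (hK.treeSigma_le n)).symm.trans (integral_congr_ae ?_)
  filter_upwards [hpull, hK.condExp_ancestors_parent hn f] with ω hω hcond
  exact hω.trans (congrArg (H ω * ·) hcond)

theorem IsWRT.integral_ancestors_parent (hK : IsWRT P w K) {n : ℕ} (hn : 1 ≤ n)
    (f : Finset ℕ → ℝ) :
    ∫ ω, f (ancestors (K · ω) (K (n + 1) ω)) ∂P = ∫ ω, vertexAvg w (K · ω) n f ∂P := by
  simpa using hK.integral_mul_ancestors_parent hn f (H := fun _ => 1) measurable_const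
    (memLp_const 1)

theorem IsWRT.integral_vertexAvg_succ (hK : IsWRT P w K)
    (hW : ∀ n, 1 ≤ n → totalWeight w n ≠ 0) {n : ℕ} (hn : 1 ≤ n) (f : Finset ℕ → ℝ) :
    ∫ ω, vertexAvg w (K · ω) (n + 1) f ∂P = ∫ ω, vertexAvg w (K · ω) n (fun s =>
      (1 - weightRatio w (n + 1)) * f s + weightRatio w (n + 1) * f (insert (n + 1) s)) ∂P := by
  have hint : ∀ g, Integrable (fun ω => vertexAvg w (K · ω) n g) P := fun g =>
    (hK.memLp_vertexAvg n g 1).integrable le_rfl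
  simp_rw [fun ω => vertexAvg_succ (K := (K · ω)) (hW n hn) (hW (n + 1) (by lia))
    (hK.parent_mem n hn ω) f, vertexAvg_linear_combination]
  rw [integral_add ((hint f).const_mul _) (((hK.memLp_ancestors_parent hn
      (fun s => f (insert (n + 1) s)) 1).integrable le_rfl).const_mul _),
    integral_add ((hint f).const_mul _) ((hint _).const_mul _), integral_const_mul,
    integral_const_mul, integral_const_mul,
    hK.integral_ancestors_parent hn fun s => f (insert (n + 1) s)]

theorem IsWRT.integral_vertexAvg_sq_succ_le (hK : IsWRT P w K)
    (hW : ∀ n, 1 ≤ n → totalWeight w n ≠ 0) {n : ℕ} (hn : 1 ≤ n) (f : Finset ℕ → ℝ) :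
    ∫ ω, vertexAvg w (K · ω) (n + 1) f ^ 2 ∂P ≤
      ∫ ω, vertexAvg w (K · ω) n (fun s =>
        (1 - weightRatio w (n + 1)) * f s + weightRatio w (n + 1) * f (insert (n + 1) s)) ^ 2 ∂P +
      weightRatio w (n + 1) ^ 2 *
        ∫ ω, vertexAvg w (K · ω) n (fun s => f (insert (n + 1) s) ^ 2) ∂P := by
  set q := weightRatio w (n + 1)
  set g : Finset ℕ → ℝ := fun s => f (insert (n + 1) s)
  let M := fun ω => vertexAvg w (K · ω) n f
  let G := fun ω => vertexAvg w (K · ω) n g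
  let X := fun ω => g (ancestors (K · ω) (K (n + 1) ω))
  let Z := fun ω => vertexAvg w (K · ω) n fun s => (1 - q) * f s + q * g s
  have hM : MemLp M 2 P := hK.memLp_vertexAvg n f 2
  have hX : MemLp X 2 P := hK.memLp_ancestors_parent hn g 2
  have hpointwise : ∀ ω, vertexAvg w (K · ω) (n + 1) f ^ 2 ≤
      Z ω ^ 2 + q ^ 2 * X ω ^ 2 + 2 * q * (1 - q) * (M ω * X ω - M ω * G ω) := by
    intro ω
    have hsucc : vertexAvg w (K · ω) (n + 1) f = (1 - q) * M ω + q * X ω :=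
      vertexAvg_succ (hW n hn) (hW (n + 1) (by lia)) (hK.parent_mem n hn ω) f
    have hZ : Z ω = (1 - q) * M ω + q * G ω := vertexAvg_linear_combination ..
    rw [hsucc, hZ]
    nlinarith [sq_nonneg (q * G ω)]
  have hMX : Integrable (fun ω => M ω * X ω) P := hM.integrable_mul hX
  have hMG : Integrable (fun ω => M ω * G ω) P := hM.integrable_mul (hK.memLp_vertexAvg n g 2)
  have hZ2 : Integrable (fun ω => Z ω ^ 2) P := (hK.memLp_vertexAvg n _ 2).integrable_sq
  have hX2 : Integrable (fun ω => q ^ 2 * X ω ^ 2) P := hX.integrable_sq.const_mul _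
  have hsum : Integrable (fun ω => Z ω ^ 2 + q ^ 2 * X ω ^ 2) P := hZ2.add hX2
  have hdiff : Integrable (fun ω => M ω * X ω - M ω * G ω) P := hMX.sub hMG
  have horth : ∫ ω, M ω * X ω ∂P = ∫ ω, M ω * G ω ∂P :=
    hK.integral_mul_ancestors_parent hn g (hK.measurable_vertexAvg n f) hM
  refine (integral_mono (hK.memLp_vertexAvg (n + 1) f 2).integrable_sq
    (hsum.add (hdiff.const_mul _)) hpointwise).trans_eq ?_
  rw [integral_add' hsum (hdiff.const_mul _), integral_const_mul,
    integral_sub hMX hMG, horth, sub_self, mul_zero, add_zero, integral_add hZ2 hX2,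
    integral_const_mul, hK.integral_ancestors_parent hn fun s => g s ^ 2]

end FiniteMeasure

variable [IsProbabilityMeasure P]

theorem IsWRT.integral_vertexAvg (hK : IsWRT P w K)
    (hW : ∀ n, 1 ≤ n → totalWeight w n ≠ 0) {m n : ℕ} (hm : 1 ≤ m) (hmn : m ≤ n)
    (f : Finset ℕ → ℝ) :
    ∫ ω, vertexAvg w (K · ω) n (fun s => f (s ∩ Ioc m n)) ∂P =
      subsetAvg (weightRatio w) (Ioc m n) f := by
  induction n, hmn using Nat.le_induction generalizing f with
  | base => simp [vertexAvg_const (hW m hm)]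
  | succ n hmn ih =>
    rw [hK.integral_vertexAvg_succ hW (hm.trans hmn), subsetAvg_Ioc_add_one _ hmn, ← ih]
    refine integral_congr_ae (ae_of_all _ fun ω => vertexAvg_congr fun s hs => ?_)
    rw [inter_Ioc_add_one hmn hs, insert_inter_Ioc_add_one hmn]

theorem IsWRT.integral_vertexAvg_sq_le (hK : IsWRT P w K)
    (hW : ∀ n, 1 ≤ n → totalWeight w n ≠ 0) {m n : ℕ} (hm : 1 ≤ m) (hmn : m ≤ n)
    (f : Finset ℕ → ℝ) :
    ∫ ω, vertexAvg w (K · ω) n (fun s => f (s ∩ Ioc m n)) ^ 2 ∂P ≤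
      subsetAvg (weightRatio w) (Ioc m n) f ^ 2 + splitSum w m n f := by
  induction n, hmn using Nat.le_induction generalizing f with
  | base => simp [vertexAvg_const (hW m hm), splitSum]
  | succ n hmn ih =>
    refine (hK.integral_vertexAvg_sq_succ_le hW (hm.trans hmn) _).trans ?_
    rw [subsetAvg_Ioc_add_one _ hmn, splitSum_add_one w hmn, ← add_assoc,
      ← hK.integral_vertexAvg hW hm hmn fun a => f (insert (n + 1) a) ^ 2]
    simp only [insert_inter_Ioc_add_one hmn]
    refine add_le_add_left (le_of_eq_of_le ?_ (ih _)) _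
    refine integral_congr_ae (ae_of_all _
      fun ω => congrArg (· ^ 2) (vertexAvg_congr fun s hs => ?_))
    rw [inter_Ioc_add_one hmn hs]

end Moments

/-! ### Excursions -/

theorem sum_comp_eq_card_mul_add_sum {α : Type*} (θ : ℕ → ℝ) {m n : ℕ} {A : Finset α} {τ : α → ℕ}
    (hτ : ∀ a ∈ A, τ a ∈ Icc m n) :
    ∑ a ∈ A, θ (τ a) =
      #A * θ m + ∑ r ∈ Ico m n, (#{a ∈ A | r < τ a} : ℝ) * (θ (r + 1) - θ r) := by
  have htelescope : ∀ a ∈ A, θ (τ a) =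
      θ m + ∑ r ∈ Ico m n, if r < τ a then θ (r + 1) - θ r else 0 := by
    intro a ha
    have ⟨hm, hn⟩ := mem_Icc.1 (hτ a ha)
    have hfilter : {r ∈ Ico m n | r < τ a} = Ico m (τ a) := by grind
    rw [← sum_filter, hfilter, sum_Ico_sub θ hm, add_sub_cancel]
  rw [sum_congr rfl htelescope, sum_add_distrib, sum_const, nsmul_eq_mul, sum_comm]
  simp only [← sum_filter, sum_const, nsmul_eq_mul]

theorem sum_comp_le_sum_comp_of_card_filter_le {α β : Type*} {θ : ℕ → ℝ} {m n : ℕ}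
    (hθ : MonotoneOn θ (Set.Ici m)) (hθm : 0 ≤ θ m) {A : Finset α} {τ : α → ℕ} {B : Finset β}
    {σ : β → ℕ} (hτ : ∀ a ∈ A, τ a ∈ Icc m n) (hσ : ∀ b ∈ B, σ b ∈ Icc m n) (hAB : #A ≤ #B)
    (hfilter : ∀ r ∈ Ico m n, #{a ∈ A | r < τ a} ≤ #{b ∈ B | r < σ b}) :
    ∑ a ∈ A, θ (τ a) ≤ ∑ b ∈ B, θ (σ b) := by
  rw [sum_comp_eq_card_mul_add_sum θ hτ, sum_comp_eq_card_mul_add_sum θ hσ]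
  gcongr with r hr
  · have hmr : m ≤ r := (mem_Ico.1 hr).1
    exact sub_nonneg.2 (hθ hmr (Set.mem_Ici.2 (by lia)) r.le_succ)
  · exact hfilter r hr

section TimeIndex

variable {i : ℕ → ℕ}

theorem timeIndex_apply (hi : StrictMono i) (t : ℕ) : timeIndex i (i t) = t :=
  (timeIndex_eq_iff hi t).2 ⟨le_rfl, fun h => hi (by lia)⟩

theorem timeIndex_le_iff (hi : StrictMono i) {j r : ℕ} : timeIndex i j ≤ r ↔ j ≤ i r := by
  refine ⟨fun h => ?_, fun h => Nat.sInf_le h⟩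
  exact ((timeIndex_eq_iff hi _).1 rfl).1.trans (hi.monotone h)

theorem lt_timeIndex_iff (hi : StrictMono i) {r j : ℕ} : r < timeIndex i j ↔ i r < j :=
  not_le.symm.trans ((timeIndex_le_iff hi).not.trans not_le)

theorem timeIndex_mem_Icc_iff (hi : StrictMono i) {T t j : ℕ} :
    timeIndex i j ∈ Icc (T + 1) t ↔ j ∈ Ioc (i T) (i t) := by
  rw [mem_Icc, mem_Ioc, timeIndex_le_iff hi, Nat.add_one_le_iff, lt_timeIndex_iff hi]

theorem sum_Ioc_le_sum_timeIndex (hi : StrictMono i) {θ : ℕ → ℝ} {T t : ℕ}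
    (hθ : MonotoneOn θ (Set.Ioi T)) (hθ0 : 0 ≤ θ (T + 1)) {u : Finset ℕ} (hu : u ⊆ Ioc (i T) (i t))
    (hcard : ∀ r, T ≤ r → t - r ≤ #{j ∈ u | i r < j}) :
    ∑ r ∈ Ioc T t, θ r ≤ ∑ j ∈ u, θ (timeIndex i j) := by
  refine sum_comp_le_sum_comp_of_card_filter_le (m := T + 1) (n := t) (τ := id)
    (σ := timeIndex i) (hθ.mono (Set.Ici_subset_Ioi.2 T.lt_succ_self)) hθ0 (fun r hr => ?_)
    (fun j hj => (timeIndex_mem_Icc_iff hi).2 (hu hj)) ?_ fun r hr => ?_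
  · simpa [Nat.add_one_le_iff] using hr
  · rw [Nat.card_Ioc]
    exact (hcard T le_rfl).trans (card_filter_le _ _)
  · rw [mem_Ico] at hr
    have hIoc : {a ∈ Ioc T t | r < id a} = Ioc r t := by grind
    rw [hIoc, Nat.card_Ioc]
    simpa only [lt_timeIndex_iff hi] using hcard r (by lia)

end TimeIndex

/-- A set `s` of labels in `(i_T, i_t]` for which the path `r ↦ #(s ∩ (i_T, i_{T+r}]) - r`,
`0 ≤ r ≤ t - T`, is an excursion below `0` that ends at `0`. -/
structure IsExcursion (i : ℕ → ℕ) (T t : ℕ) (s : Finset ℕ) : Prop where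
  subset : s ⊆ Ioc (i T) (i t)
  card_eq : #s = t - T
  card_filter_le : ∀ r < t - T, #{j ∈ s | j ≤ i (T + r)} ≤ r

namespace IsExcursion

variable {i : ℕ → ℕ} {T t : ℕ} {u : Finset ℕ}

theorem le_card_filter_lt (hu : IsExcursion i T t u) {r : ℕ} (hTr : T ≤ r) :
    t - r ≤ #{j ∈ u | i r < j} := by
  rcases lt_or_ge r t with hrt | hrt
  · have hsplit := card_filter_add_card_filter_not (s := u) (fun j => j ≤ i r)
    have hle := hu.card_filter_le (r - T) (by lia)
    have hcard := hu.card_eq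
    rw [Nat.add_sub_cancel' hTr] at hle
    simp only [not_le] at hsplit
    lia
  · lia

theorem sum_Ioc_le (hi : StrictMono i) {θ : ℕ → ℝ} (hθ : MonotoneOn θ (Set.Ioi T))
    (hθ0 : 0 ≤ θ (T + 1)) (hu : IsExcursion i T t u) :
    ∑ r ∈ Ioc T t, θ r ≤ ∑ j ∈ u, θ (timeIndex i j) :=
  sum_Ioc_le_sum_timeIndex hi hθ hθ0 hu.subset fun _ hr => hu.le_card_filter_lt hr

theorem le_card_filter_lt_of_mem (hi : StrictMono i) (hu : IsExcursion i T t u) {l : ℕ}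
    (hl : l ∈ u) {r : ℕ} (hr : timeIndex i l - 1 ≤ r) :
    t - r ≤ #{j ∈ {j ∈ u | l ≤ j} | i r < j} := by
  have hTl : T < timeIndex i l := (lt_timeIndex_iff hi).2 (mem_Ioc.1 (hu.subset hl)).1
  have hl_le : l ≤ i (timeIndex i l) := (timeIndex_le_iff hi).1 le_rfl
  rcases hr.eq_or_lt with rfl | hr
  · have hlt : i (timeIndex i l - 1) < l := (lt_timeIndex_iff hi).1 (by lia)
    have hsub : insert l {j ∈ u | i (timeIndex i l) < j} ⊆
        {j ∈ {j ∈ u | l ≤ j} | i (timeIndex i l - 1) < j} := by grind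
    have hcard := card_le_card hsub
    rw [card_insert_of_notMem (by simp [hl_le])] at hcard
    have := hu.le_card_filter_lt hTl.le
    lia
  · have hir : i (timeIndex i l) ≤ i r := hi.monotone (by lia)
    refine (hu.le_card_filter_lt (by lia)).trans (card_le_card fun j hj => ?_)
    grind

theorem sum_Ioc_le_sum_filter (hi : StrictMono i) {θ : ℕ → ℝ} (hθ : MonotoneOn θ (Set.Ioi T))
    (hθ0 : ∀ r, T < r → 0 ≤ θ r) (hu : IsExcursion i T t u) {l : ℕ} (hl : l ∈ u) :
    ∑ r ∈ Ioc (timeIndex i l - 1) t, θ r ≤ ∑ j ∈ u with l ≤ j, θ (timeIndex i j) := by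
  have hTl : T < timeIndex i l := (lt_timeIndex_iff hi).2 (mem_Ioc.1 (hu.subset hl)).1
  have hlt : i (timeIndex i l - 1) < l := (lt_timeIndex_iff hi).1 (by lia)
  refine sum_Ioc_le_sum_timeIndex hi (hθ.mono (Set.Ioi_subset_Ioi (by lia))) (hθ0 _ (by lia))
    (fun j hj => ?_) fun r hr => hu.le_card_filter_lt_of_mem hi hl hr
  rw [mem_filter] at hj
  exact mem_Ioc.2 ⟨hlt.trans_le hj.2, (mem_Ioc.1 (hu.subset hj.1)).2⟩

theorem card_filter_le_sub_eq (hu : IsExcursion i T t u) {r : ℕ} (hr : r ≤ t - T) :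
    (#{j ∈ u | j ≤ i (T + r)} : ℝ) - r =
      ((t - (T + r) : ℕ) : ℝ) - #{j ∈ u | i (T + r) < j} := by
  have hsplit := card_filter_add_card_filter_not (s := u) (fun j => j ≤ i (T + r))
  have hcard := hu.card_eq
  simp only [not_le] at hsplit
  rw [sub_eq_sub_iff_add_eq_add]
  norm_cast
  lia

theorem sum_Icc_eq (hi : StrictMono i) (θ : ℕ → ℝ) (hu : IsExcursion i T t u) :
    ∑ r ∈ Icc 1 (t - T - 1),
        (θ (T + r + 1) - θ (T + r)) * ((#{j ∈ u | j ≤ i (T + r)} : ℝ) - r) =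
      ∑ r ∈ Ioc T t, θ r - ∑ j ∈ u, θ (timeIndex i j) := by
  have hu_mem : ∀ j ∈ u, timeIndex i j ∈ Icc (T + 1) t := fun j hj =>
    (timeIndex_mem_Icc_iff hi).2 (hu.subset hj)
  have hIoc_mem : ∀ r ∈ Ioc T t, id r ∈ Icc (T + 1) t := fun r hr => by
    simpa [Nat.add_one_le_iff] using hr
  have hIcc : Icc 1 (t - T - 1) = Ico 1 (t - T) := by grind
  have hu_sum := sum_comp_eq_card_mul_add_sum θ hu_mem
  have hIoc_sum := sum_comp_eq_card_mul_add_sum θ hIoc_mem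
  simp only [id] at hIoc_sum
  rw [hu_sum, hIoc_sum, hu.card_eq, Nat.card_Ioc, add_sub_add_left_eq_sub, ← sum_sub_distrib,
    hIcc]
  rcases le_total t T with htT | hTt
  · rw [Ico_eq_empty (by lia), Ico_eq_empty (by lia), sum_empty, sum_empty]
  rw [show Ico (T + 1) t = Ico (1 + T) (t - T + T) by grind, ← sum_Ico_add' _ 1 (t - T) T]
  refine sum_congr rfl fun r hr => ?_
  have hIoc : {a ∈ Ioc T t | T + r < a} = Ioc (T + r) t := by grind
  rw [hu.card_filter_le_sub_eq (mem_Ico.1 hr).2.le, add_comm r T, hIoc, Nat.card_Ioc]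
  simp only [lt_timeIndex_iff hi]
  ring

end IsExcursion

theorem walk_sub_walk {i : ℕ → ℕ} (hi : Monotone i) (Y : ℕ → ℕ) {T r t : ℕ} (h : T + r ≤ t) :
    walk i (i t) Y (T + r) - walk i (i t) Y T =
      (∑ j ∈ Ioc (i T) (i (T + r)), (Y j : ℤ)) - r := by
  induction r with
  | zero => simp
  | succ r ih =>
    have hstep : walk i (i t) Y (T + (r + 1)) = walk i (i t) Y (T + r) +
        ((∑ j ∈ Ioc (i (T + r)) (i (T + (r + 1))), (Y j : ℤ)) - 1) := by
      rw [walk, ← add_assoc, sum_Icc_succ_top (by lia), walk, Nat.add_sub_cancel,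
        min_eq_left (hi (by lia))]
    have hconsec := sum_Ioc_consecutive (fun j => (Y j : ℤ))
      (hi (show T ≤ T + r by lia)) (hi (show T + r ≤ T + (r + 1) by lia))
    rw [hstep, ← hconsec, add_sub_right_comm, ih (by lia)]
    push_cast
    ring

section Walk

variable {i : ℕ → ℕ} {T t : ℕ} {Y : ℕ → ℕ}

theorem walk_sub_walk_eq_card_filter (hi : Monotone i) (hY : ∀ j, Y j = 0 ∨ Y j = 1) {r : ℕ}
    (h : T + r ≤ t) :
    walk i (i t) Y (T + r) - walk i (i t) Y T =
      (#{j ∈ {j ∈ Ioc (i T) (i t) | Y j = 1} | j ≤ i (T + r)} : ℤ) - r := by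
  have hY' : ∀ j, (Y j : ℤ) = if Y j = 1 then 1 else 0 := by
    intro j
    rcases hY j with h | h <;> simp [h]
  have hfilter : {j ∈ {j ∈ Ioc (i T) (i t) | Y j = 1} | j ≤ i (T + r)} =
      {j ∈ Ioc (i T) (i (T + r)) | Y j = 1} := by
    have := hi h
    grind
  rw [walk_sub_walk hi Y h, sum_congr rfl fun j _ => hY' j, ← sum_filter, sum_const, nsmul_one,
    hfilter]

theorem isExcursion_filter_iff (hi : Monotone i) (hTt : T ≤ t) (hY : ∀ j, Y j = 0 ∨ Y j = 1) :
    IsExcursion i T t {j ∈ Ioc (i T) (i t) | Y j = 1} ↔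
      walk i (i t) Y t = walk i (i t) Y T ∧
        ∀ r < t - T, walk i (i t) Y (T + r) ≤ walk i (i t) Y T := by
  set u := {j ∈ Ioc (i T) (i t) | Y j = 1}
  have hwalk : ∀ r, T + r ≤ t →
      walk i (i t) Y (T + r) - walk i (i t) Y T = (#{j ∈ u | j ≤ i (T + r)} : ℤ) - r :=
    fun r hr => walk_sub_walk_eq_card_filter hi hY hr
  have hend := hwalk (t - T) (by lia)
  rw [Nat.add_sub_cancel' hTt, filter_true_of_mem (p := (· ≤ i t)) (s := u) (by grind)] at hend
  have hcard : #u = t - T ↔ walk i (i t) Y t = walk i (i t) Y T := by lia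
  have hcard_filter : ∀ r < t - T,
      #{j ∈ u | j ≤ i (T + r)} ≤ r ↔ walk i (i t) Y (T + r) ≤ walk i (i t) Y T := by
    intro r hr
    have := hwalk r (by lia)
    lia
  exact ⟨fun h => ⟨hcard.1 h.card_eq, fun r hr => (hcard_filter r hr).1 (h.card_filter_le r hr)⟩,
    fun h => ⟨filter_subset _ _, hcard.2 h.1, fun r hr => (hcard_filter r hr).2 (h.2 r hr)⟩⟩

end Walk

/-- The indicator function of the set of excursions. -/
noncomputable def excursionIndicator (i : ℕ → ℕ) (T t : ℕ) : Finset ℕ → ℝ :=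
  {s | IsExcursion i T t s}.indicator 1

theorem E_eq_subsetAvg {w : ℕ → ℝ} (hw : ∀ n, 1 ≤ n → 0 ≤ w n) {i : ℕ → ℕ} (hi : StrictMono i)
    (θ : ℕ → ℝ) {T t : ℕ} (hTt : T ≤ t) :
    E w i θ (fun _ => T) (i t) = Real.exp (∑ r ∈ Ioc T t, θ r) *
      subsetAvg (tiltedProb w i θ) (Ioc (i T) (i t)) (fun s =>
        Real.exp (-∑ j ∈ s, θ (timeIndex i j)) * excursionIndicator i T t s) := by
  let p : ℕ → unitInterval := fun j => Set.projIcc 0 1 zero_le_one (tiltedProb w i θ j)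
  have hp : ∀ j ∈ Ioc (i T) (i t), tiltedProb w i θ j = p j := fun j hj => congrArg Subtype.val
    (Set.projIcc_of_mem zero_le_one (tiltedProb_mem_Icc hw i θ (by grind))).symm
  rw [subsetAvg_congr_prob hp, ← subsetAvg_const_mul,
    ← integral_filter_eq_one_infinitePi_bernoulliMeasure, E, tiltedLaw]
  refine integral_congr_ae ?_
  filter_upwards [ae_eq_zero_or_one_infinitePi_bernoulliMeasure p] with Y hY
  have hiff : {j ∈ Ioc (i T) (i t) | Y j = 1} ∈ {s | IsExcursion i T t s} ↔
      Y ∈ {Y | walk i (i t) Y t = walk i (i t) Y T ∧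
        ∀ r < t - T, walk i (i t) Y (T + r) ≤ walk i (i t) Y T} :=
    isExcursion_filter_iff hi.monotone hTt hY
  rw [timeIndex_apply hi, excursionIndicator]
  by_cases hu : {j ∈ Ioc (i T) (i t) | Y j = 1} ∈ {s | IsExcursion i T t s}
  · rw [Set.indicator_of_mem (hiff.1 hu), Set.indicator_of_mem hu, Pi.one_apply, mul_one,
      ← Real.exp_add, ← sub_eq_add_neg, ← hu.sum_Icc_eq hi θ]
    congr 1
    refine sum_congr rfl fun r hr => ?_
    rw [walk_sub_walk_eq_card_filter hi.monotone hY (by grind)]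
    push_cast
    rfl
  · rw [Set.indicator_of_notMem (hiff.not.1 hu), Set.indicator_of_notMem hu, mul_zero, mul_zero]

/-! ### The exponential tilt -/

section Tilt

variable {w : ℕ → ℝ} {i : ℕ → ℕ} {θ : ℕ → ℝ} {T t : ℕ}

/-- The normalizing constant `1 + (e^{θ_{t_j}} - 1) w_j / W_j` of the tilted Bernoulli law at
label `j`, that is, the denominator of `tiltedProb w i θ j`. -/
noncomputable def tiltMass (w : ℕ → ℝ) (i : ℕ → ℕ) (θ : ℕ → ℝ) (j : ℕ) : ℝ :=
  1 + (Real.exp (θ (timeIndex i j)) - 1) * weightRatio w j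

theorem tiltMass_pos (hw : ∀ n, 1 ≤ n → 0 ≤ w n) (i : ℕ → ℕ) (θ : ℕ → ℝ) {j : ℕ} (hj : 1 ≤ j) :
    0 < tiltMass w i θ j := by
  obtain ⟨h0, h1⟩ := weightRatio_mem_Icc hw hj
  have hexp := Real.exp_pos (θ (timeIndex i j))
  rw [tiltMass]
  rcases h0.eq_or_lt with h | h
  · rw [← h, mul_zero, add_zero]
    exact one_pos
  · nlinarith [mul_pos hexp h]

theorem prod_tiltMass_pos (hw : ∀ n, 1 ≤ n → 0 ≤ w n) (i : ℕ → ℕ) (θ : ℕ → ℝ) (m n : ℕ) :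
    0 < ∏ j ∈ Ioc m n, tiltMass w i θ j :=
  prod_pos fun _ hj => tiltMass_pos hw i θ (Nat.one_le_of_lt (mem_Ioc.1 hj).1)

theorem one_le_tiltMass (hw : ∀ n, 1 ≤ n → 0 ≤ w n) {j : ℕ} (hj : 1 ≤ j)
    (hθ : 0 ≤ θ (timeIndex i j)) : 1 ≤ tiltMass w i θ j :=
  le_add_of_nonneg_right
    (mul_nonneg (sub_nonneg.2 (Real.one_le_exp hθ)) (weightRatio_mem_Icc hw hj).1)

theorem tiltedProb_mem_Icc_of_mem_Ioc (hw : ∀ n, 1 ≤ n → 0 ≤ w n) (i : ℕ → ℕ) (θ : ℕ → ℝ)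
    {m n : ℕ} : ∀ j ∈ Ioc m n, tiltedProb w i θ j ∈ Set.Icc (0 : ℝ) 1 :=
  fun _ hj => tiltedProb_mem_Icc hw i θ (Nat.one_le_of_lt (mem_Ioc.1 hj).1)

theorem subsetAvg_weightRatio_eq (hw : ∀ n, 1 ≤ n → 0 ≤ w n) (i : ℕ → ℕ) (θ : ℕ → ℝ) (m n : ℕ)
    (F : Finset ℕ → ℝ) :
    subsetAvg (weightRatio w) (Ioc m n) F = (∏ j ∈ Ioc m n, tiltMass w i θ j) *
      subsetAvg (tiltedProb w i θ) (Ioc m n)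
        (fun s => Real.exp (-∑ j ∈ s, θ (timeIndex i j)) * F s) :=
  subsetAvg_eq_prod_mul_subsetAvg_tilted (ψ := fun j => θ (timeIndex i j))
    (fun _ hj => tiltMass_pos hw i θ (Nat.one_le_of_lt (mem_Ioc.1 hj).1)) F

/-- The factor between `E` and the probability that the labels in `(i_T, i_t]`, each kept
independently with probability `w_j / W_j`, form an excursion. -/
noncomputable def meanScale (w : ℕ → ℝ) (i : ℕ → ℕ) (θ : ℕ → ℝ) (T t : ℕ) : ℝ :=
  (∏ j ∈ Ioc (i T) (i t), tiltMass w i θ j) * Real.exp (-∑ r ∈ Ioc T t, θ r)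

theorem meanScale_pos (hw : ∀ n, 1 ≤ n → 0 ≤ w n) (i : ℕ → ℕ) (θ : ℕ → ℝ) (T t : ℕ) :
    0 < meanScale w i θ T t :=
  mul_pos (prod_tiltMass_pos hw i θ _ _) (Real.exp_pos _)

theorem E_nonneg (w : ℕ → ℝ) (i : ℕ → ℕ) (θ : ℕ → ℝ) (T : ℕ → ℕ) (n : ℕ) : 0 ≤ E w i θ T n :=
  integral_nonneg fun _ => Set.indicator_nonneg (fun _ _ => (Real.exp_pos _).le) _

theorem subsetAvg_excursionIndicator (hw : ∀ n, 1 ≤ n → 0 ≤ w n) (hi : StrictMono i) (θ : ℕ → ℝ)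
    (hTt : T ≤ t) :
    subsetAvg (weightRatio w) (Ioc (i T) (i t)) (excursionIndicator i T t) =
      meanScale w i θ T t * E w i θ (fun _ => T) (i t) := by
  rw [subsetAvg_weightRatio_eq hw i θ, E_eq_subsetAvg hw hi θ hTt, meanScale, mul_assoc,
    ← mul_assoc (Real.exp _), ← Real.exp_add, neg_add_cancel, Real.exp_zero, one_mul]

end Tilt

/-! ### Bounding the pairs of ancestral lines that split at a given label -/

section Split

variable {w : ℕ → ℝ} {i : ℕ → ℕ} {θ : ℕ → ℝ} {T t l : ℕ}

theorem IsExcursion.two_mul_sum_Ioc_le (hi : StrictMono i) (hθ : MonotoneOn θ (Set.Ioi T))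
    (hθ0 : ∀ r, T < r → 0 ≤ θ r) {a s : Finset ℕ} (ha : a ⊆ Ioc (i T) (l - 1))
    (hs : s ⊆ Ioc l (i t)) (hu : IsExcursion i T t (insert l a ∪ s)) :
    2 * ∑ r ∈ Ioc T t, θ r ≤ ∑ j ∈ a, θ (timeIndex i j) + ∑ r ∈ Ioc T (timeIndex i l - 1), θ r +
      2 * (θ (timeIndex i l) + ∑ j ∈ s, θ (timeIndex i j)) := by
  have hl : l ∈ Ioc (i T) (i t) := hu.subset (by simp)
  have hla : l ∉ a := fun h => by grind
  have hls : l ∉ s := fun h => by grind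
  have hdisj : Disjoint (insert l a) s := disjoint_left.2 fun j hj hjs => by grind
  have hfilter : {j ∈ insert l a ∪ s | l ≤ j} = insert l s := by grind
  have hwhole := hu.sum_Ioc_le hi hθ (hθ0 _ T.lt_succ_self)
  have habove := hu.sum_Ioc_le_sum_filter hi hθ hθ0 (l := l) (by simp)
  rw [sum_union hdisj, sum_insert hla] at hwhole
  rw [hfilter, sum_insert hls] at habove
  have ⟨hTl, hlt⟩ := mem_Icc.1 ((timeIndex_mem_Icc_iff hi).2 hl)
  have hconsec := sum_Ioc_consecutive θ (show T ≤ timeIndex i l - 1 by lia)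
    (show timeIndex i l - 1 ≤ t by lia)
  linarith

theorem exp_neg_sum_mul_excursionIndicator_le (hi : StrictMono i)
    (hθ : MonotoneOn θ (Set.Ioi T)) (hθ0 : ∀ r, T < r → 0 ≤ θ r) {a s : Finset ℕ}
    (ha : a ⊆ Ioc (i T) (l - 1)) (hs : s ⊆ Ioc l (i t)) :
    Real.exp (-∑ j ∈ s, θ (timeIndex i j)) * excursionIndicator i T t (insert l a ∪ s) ≤
      Real.exp ((2 * θ (timeIndex i l) + ∑ r ∈ Ioc T (timeIndex i l - 1), θ r -
        2 * ∑ r ∈ Ioc T t, θ r + ∑ j ∈ a, θ (timeIndex i j)) / 2) := by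
  by_cases hu : IsExcursion i T t (insert l a ∪ s)
  · rw [excursionIndicator, Set.indicator_of_mem (Set.mem_ofPred.2 hu), Pi.one_apply, mul_one]
    have := hu.two_mul_sum_Ioc_le hi hθ hθ0 ha hs
    exact Real.exp_le_exp.2 (by linarith)
  · rw [excursionIndicator, Set.indicator_of_notMem (by simpa using hu), mul_zero]
    exact (Real.exp_pos _).le

theorem excursionIndicator_nonneg (i : ℕ → ℕ) (T t : ℕ) (s : Finset ℕ) :
    0 ≤ excursionIndicator i T t s :=
  Set.indicator_nonneg (fun _ _ => zero_le_one) s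

theorem subsetAvg_sq_excursionIndicator_le (hw : ∀ n, 1 ≤ n → 0 ≤ w n) (hi : StrictMono i)
    (hθ : MonotoneOn θ (Set.Ioi T)) (hθ0 : ∀ r, T < r → 0 ≤ θ r) :
    subsetAvg (weightRatio w) (Ioc (i T) (l - 1)) (fun a =>
        subsetAvg (weightRatio w) (Ioc l (i t))
          (fun s => excursionIndicator i T t (insert l a ∪ s)) ^ 2) ≤
      (∏ j ∈ Ioc (i T) (l - 1), tiltMass w i θ j) *
        ((∏ j ∈ Ioc l (i t), tiltMass w i θ j) ^ 2 *
          Real.exp (2 * θ (timeIndex i l) + ∑ r ∈ Ioc T (timeIndex i l - 1), θ r -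
            2 * ∑ r ∈ Ioc T t, θ r)) := by
  set c := 2 * θ (timeIndex i l) + ∑ r ∈ Ioc T (timeIndex i l - 1), θ r - 2 * ∑ r ∈ Ioc T t, θ r
  rw [subsetAvg_weightRatio_eq hw i θ (i T)]
  refine mul_le_mul_of_nonneg_left (subsetAvg_le_of_le (tiltedProb_mem_Icc_of_mem_Ioc hw i θ)
    fun a ha => ?_) (prod_tiltMass_pos hw i θ _ _).le
  set F : Finset ℕ → ℝ := fun s =>
    Real.exp (-∑ j ∈ s, θ (timeIndex i j)) * excursionIndicator i T t (insert l a ∪ s)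
  have hF_nonneg : 0 ≤ subsetAvg (tiltedProb w i θ) (Ioc l (i t)) F :=
    subsetAvg_nonneg (tiltedProb_mem_Icc_of_mem_Ioc hw i θ) fun s _ =>
      mul_nonneg (Real.exp_pos _).le (excursionIndicator_nonneg _ _ _ _)
  have hF_le : subsetAvg (tiltedProb w i θ) (Ioc l (i t)) F ≤
      Real.exp ((c + ∑ j ∈ a, θ (timeIndex i j)) / 2) :=
    subsetAvg_le_of_le (tiltedProb_mem_Icc_of_mem_Ioc hw i θ) fun s hs =>
      exp_neg_sum_mul_excursionIndicator_le hi hθ hθ0 ha hs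
  rw [subsetAvg_weightRatio_eq hw i θ l, mul_pow, mul_left_comm]
  refine mul_le_mul_of_nonneg_left ?_ (sq_nonneg _)
  calc Real.exp (-∑ j ∈ a, θ (timeIndex i j)) *
        subsetAvg (tiltedProb w i θ) (Ioc l (i t)) F ^ 2
      ≤ Real.exp (-∑ j ∈ a, θ (timeIndex i j)) *
        Real.exp ((c + ∑ j ∈ a, θ (timeIndex i j)) / 2) ^ 2 := by gcongr
    _ = Real.exp c := by
        rw [← Real.exp_nat_mul, ← Real.exp_add]
        congr 1
        push_cast
        ring

end Split

/-! ### The second moment of the excursion weight -/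

theorem exp_sum_sub_le_prod_one_add {α : Type*} {I : Finset α} {x : α → ℝ}
    (hx : ∀ j ∈ I, 0 ≤ x j) :
    Real.exp (∑ j ∈ I, x j - (∑ j ∈ I, x j ^ 2) / 2) ≤ ∏ j ∈ I, (1 + x j) := by
  rw [sum_div, ← sum_sub_distrib, Real.exp_sum]
  refine prod_le_prod (fun j _ => (Real.exp_pos _).le) fun j hj => ?_
  have hx0 := hx j hj
  have hfrac : x j - x j ^ 2 / 2 ≤ 2 * x j / (x j + 2) := by
    rw [le_div_iff₀ (by linarith)]
    nlinarith [pow_nonneg hx0 3]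
  rw [← Real.le_log_iff_exp_le (by linarith)]
  exact hfrac.trans (Real.le_log_one_add_of_nonneg hx0)

theorem sum_le_tsum_subtype_ge (f : ℕ → ℝ≥0∞) {a : ℕ} {S : Finset ℕ} (hS : ∀ l ∈ S, a ≤ l) :
    ∑ l ∈ S, f l ≤ ∑' l : {l : ℕ // a ≤ l}, f l := by
  rw [← sum_subtype_of_mem f hS]
  exact ENNReal.sum_le_tsum _

theorem prod_Ioc_eq_mul_mul_prod {M : Type*} [CommMonoid M] (f : ℕ → M) {m n l : ℕ}
    (hl : l ∈ Ioc m n) :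
    ∏ j ∈ Ioc m n, f j = (∏ j ∈ Ioc m (l - 1), f j) * f l * ∏ j ∈ Ioc l n, f j := by
  obtain ⟨hml, hln⟩ := mem_Ioc.1 hl
  obtain ⟨l, rfl⟩ : ∃ k, l = k + 1 := ⟨l - 1, by lia⟩
  rw [← prod_Ioc_consecutive f hml.le hln, prod_Ioc_succ_top (by lia), Nat.add_sub_cancel]

section SecondMoment

variable {w : ℕ → ℝ} {i : ℕ → ℕ} {θ : ℕ → ℝ} {T t l : ℕ}

theorem delta₁_eq_tsum_sq (w : ℕ → ℝ) (i : ℕ → ℕ) (θ : ℕ → ℝ) (T : ℕ → ℕ) (n : ℕ) :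
    delta₁ w i θ T n = ∑' l : {l : ℕ // i (T n) + 1 ≤ l},
      ENNReal.ofReal ((Real.exp (θ (timeIndex i l)) * weightRatio w l) ^ 2) := by
  simp only [delta₁, weightRatio, mul_pow, div_pow, ← Real.exp_nat_mul, Nat.cast_ofNat]

/-- The summand of index `l` in `delta₂`. -/
noncomputable def delta₂Term (w : ℕ → ℝ) (i : ℕ → ℕ) (θ : ℕ → ℝ) (T l : ℕ) : ℝ :=
  (Real.exp (θ (timeIndex i l)) * weightRatio w l) ^ 2 *
    Real.exp (∑ r ∈ Ioc T (timeIndex i l - 1), θ r - ∑ j ∈ Ioc (i T) (i (timeIndex i l - 1)),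
      (Real.exp (θ (timeIndex i j)) - 1) * weightRatio w j)

theorem delta₂_eq_tsum (w : ℕ → ℝ) (i : ℕ → ℕ) (θ : ℕ → ℝ) (T : ℕ → ℕ) (n : ℕ) :
    delta₂ w i θ T n =
      ∑' l : {l : ℕ // i (T n) + 1 ≤ l}, ENNReal.ofReal (delta₂Term w i θ (T n) l) := by
  simp only [delta₂, delta₂Term, weightRatio, mul_pow, div_pow, ← Real.exp_nat_mul,
    Nat.cast_ofNat, Icc_add_one_left_eq_Ioc]

theorem ofReal_sum_delta₂Term_le (w : ℕ → ℝ) (i : ℕ → ℕ) (θ : ℕ → ℝ) (T n b : ℕ) :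
    ENNReal.ofReal (∑ l ∈ Ioc (i T) b, delta₂Term w i θ T l) ≤ delta₂ w i θ (fun _ => T) n := by
  rw [delta₂_eq_tsum, ENNReal.ofReal_sum_of_nonneg fun l _ => by rw [delta₂Term]; positivity]
  exact sum_le_tsum_subtype_ge (fun l => ENNReal.ofReal (delta₂Term w i θ T l))
    fun l hl => (mem_Ioc.1 hl).1

theorem sum_sq_le_toReal_delta₁ {n : ℕ} (hδ : delta₁ w i θ (fun _ => T) n ≠ ∞) (b : ℕ) :
    ∑ j ∈ Ioc (i T) b, (Real.exp (θ (timeIndex i j)) * weightRatio w j) ^ 2 ≤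
      (delta₁ w i θ (fun _ => T) n).toReal := by
  rw [← ENNReal.ofReal_le_iff_le_toReal hδ, ENNReal.ofReal_sum_of_nonneg fun j _ => sq_nonneg _,
    delta₁_eq_tsum_sq]
  exact sum_le_tsum_subtype_ge
    (fun l => ENNReal.ofReal ((Real.exp (θ (timeIndex i l)) * weightRatio w l) ^ 2))
    fun l hl => (mem_Ioc.1 hl).1

theorem exp_sum_le_mul_prod_tiltMass (hw : ∀ n, 1 ≤ n → 0 ≤ w n) (hi : StrictMono i)
    (hθ0 : ∀ r, T < r → 0 ≤ θ r) {n : ℕ} (hδ : delta₁ w i θ (fun _ => T) n ≠ ∞) (b : ℕ) :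
    Real.exp (∑ j ∈ Ioc (i T) b, (Real.exp (θ (timeIndex i j)) - 1) * weightRatio w j) ≤
      Real.exp ((delta₁ w i θ (fun _ => T) n).toReal / 2) *
        ∏ j ∈ Ioc (i T) b, tiltMass w i θ j := by
  set x : ℕ → ℝ := fun j => (Real.exp (θ (timeIndex i j)) - 1) * weightRatio w j
  have hq : ∀ j ∈ Ioc (i T) b, 0 ≤ weightRatio w j := fun j hj =>
    (weightRatio_mem_Icc hw (Nat.one_le_of_lt (mem_Ioc.1 hj).1)).1
  have hx : ∀ j ∈ Ioc (i T) b, 0 ≤ x j := fun j hj =>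
    mul_nonneg (sub_nonneg.2 (Real.one_le_exp
      (hθ0 _ ((lt_timeIndex_iff hi).2 (mem_Ioc.1 hj).1)))) (hq j hj)
  have hsq : ∑ j ∈ Ioc (i T) b, x j ^ 2 ≤ (delta₁ w i θ (fun _ => T) n).toReal := by
    refine (sum_le_sum fun j hj => pow_le_pow_left₀ (hx j hj) ?_ 2).trans
      (sum_sq_le_toReal_delta₁ hδ b)
    exact mul_le_mul_of_nonneg_right (sub_le_self _ zero_le_one) (hq j hj)
  calc Real.exp (∑ j ∈ Ioc (i T) b, x j)
      ≤ Real.exp ((delta₁ w i θ (fun _ => T) n).toReal / 2 +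
          (∑ j ∈ Ioc (i T) b, x j - (∑ j ∈ Ioc (i T) b, x j ^ 2) / 2)) :=
        Real.exp_le_exp.2 (by linarith)
    _ ≤ _ := by
        rw [Real.exp_add]
        exact mul_le_mul_of_nonneg_left (exp_sum_sub_le_prod_one_add hx) (Real.exp_pos _).le

theorem one_le_exp_toReal_delta₁_mul_prod_tiltMass (hw : ∀ n, 1 ≤ n → 0 ≤ w n)
    (hi : StrictMono i) (hθ0 : ∀ r, T < r → 0 ≤ θ r) {n : ℕ}
    (hδ : delta₁ w i θ (fun _ => T) n ≠ ∞) (hl : i T < l) :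
    1 ≤ Real.exp ((delta₁ w i θ (fun _ => T) n).toReal / 2) *
      (∏ j ∈ Ioc (i T) (l - 1), tiltMass w i θ j) *
        Real.exp (-∑ j ∈ Ioc (i T) (i (timeIndex i l - 1)),
          (Real.exp (θ (timeIndex i j)) - 1) * weightRatio w j) := by
  have hil : i (timeIndex i l - 1) < l :=
    (lt_timeIndex_iff hi).1 (by have := (lt_timeIndex_iff hi).2 hl; lia)
  have hone : ∀ j ∈ Ioc (i T) (l - 1), 1 ≤ tiltMass w i θ j := fun j hj =>
    one_le_tiltMass hw (Nat.one_le_of_lt (mem_Ioc.1 hj).1)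
      (hθ0 _ ((lt_timeIndex_iff hi).2 (mem_Ioc.1 hj).1))
  have hprod : ∏ j ∈ Ioc (i T) (i (timeIndex i l - 1)), tiltMass w i θ j ≤
      ∏ j ∈ Ioc (i T) (l - 1), tiltMass w i θ j :=
    prod_le_prod_of_subset_of_one_le (Ioc_subset_Ioc_right (by lia))
      (fun j hj => (tiltMass_pos hw i θ (Nat.one_le_of_lt (mem_Ioc.1 hj).1)).le)
      fun j hj _ => hone j hj
  rw [Real.exp_neg, ← div_eq_mul_inv, one_le_div (Real.exp_pos _)]
  exact (exp_sum_le_mul_prod_tiltMass hw hi hθ0 hδ _).trans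
    (mul_le_mul_of_nonneg_left hprod (Real.exp_pos _).le)

theorem sq_weightRatio_mul_subsetAvg_sq_excursionIndicator_le (hw : ∀ n, 1 ≤ n → 0 ≤ w n)
    (hi : StrictMono i) (hθ : MonotoneOn θ (Set.Ioi T)) (hθ0 : ∀ r, T < r → 0 ≤ θ r) {n : ℕ}
    (hδ : delta₁ w i θ (fun _ => T) n ≠ ∞) (hl : l ∈ Ioc (i T) (i t)) :
    weightRatio w l ^ 2 * subsetAvg (weightRatio w) (Ioc (i T) (l - 1)) (fun a =>
        subsetAvg (weightRatio w) (Ioc l (i t))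
          (fun s => excursionIndicator i T t (insert l a ∪ s)) ^ 2) ≤
      meanScale w i θ T t ^ 2 *
        (Real.exp ((delta₁ w i θ (fun _ => T) n).toReal / 2) * delta₂Term w i θ T l) := by
  have hTl := (mem_Ioc.1 hl).1
  have hsplit := subsetAvg_sq_excursionIndicator_le (t := t) (l := l) hw hi hθ hθ0
  have hone := one_le_exp_toReal_delta₁_mul_prod_tiltMass hw hi hθ0 hδ hTl
  have hmass : 1 ≤ tiltMass w i θ l :=
    one_le_tiltMass hw (Nat.one_le_of_lt hTl) (hθ0 _ ((lt_timeIndex_iff hi).2 hTl))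
  have hbelow := prod_tiltMass_pos hw i θ (i T) (l - 1)
  rw [meanScale, prod_Ioc_eq_mul_mul_prod _ hl, delta₂Term, sub_eq_add_neg, Real.exp_add]
  rw [sub_eq_add_neg, Real.exp_add, Real.exp_add] at hsplit
  set A := ∏ j ∈ Ioc (i T) (l - 1), tiltMass w i θ j
  set B := ∏ j ∈ Ioc l (i t), tiltMass w i θ j
  set D := Real.exp ((delta₁ w i θ (fun _ => T) n).toReal / 2)
  set X := ∑ j ∈ Ioc (i T) (i (timeIndex i l - 1)),
    (Real.exp (θ (timeIndex i j)) - 1) * weightRatio w j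
  set Θ := ∑ r ∈ Ioc T t, θ r
  set Θl := ∑ r ∈ Ioc T (timeIndex i l - 1), θ r
  have hexpθ : Real.exp (2 * θ (timeIndex i l)) = Real.exp (θ (timeIndex i l)) ^ 2 := by
    rw [← Real.exp_nat_mul, Nat.cast_ofNat]
  have hexpΘ : Real.exp (-(2 * Θ)) = Real.exp (-Θ) ^ 2 := by
    rw [← Real.exp_nat_mul, Nat.cast_ofNat, mul_neg]
  rw [hexpθ, hexpΘ] at hsplit
  calc _ ≤ weightRatio w l ^ 2 * (A * (B ^ 2 *
        (Real.exp (θ (timeIndex i l)) ^ 2 * Real.exp Θl * Real.exp (-Θ) ^ 2))) :=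
        mul_le_mul_of_nonneg_left hsplit (sq_nonneg _)
    _ ≤ weightRatio w l ^ 2 * (A * (B ^ 2 *
        (Real.exp (θ (timeIndex i l)) ^ 2 * Real.exp Θl * Real.exp (-Θ) ^ 2))) *
          (tiltMass w i θ l ^ 2 * (D * A * Real.exp (-X))) :=
        le_mul_of_one_le_right (by positivity)
          (one_le_mul_of_one_le_of_one_le (one_le_pow₀ hmass) hone)
    _ = _ := by ring

theorem splitSum_excursionIndicator_le (hw : ∀ n, 1 ≤ n → 0 ≤ w n) (hi : StrictMono i)
    (hθ : MonotoneOn θ (Set.Ioi T)) (hθ0 : ∀ r, T < r → 0 ≤ θ r) {n : ℕ}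
    (hδ : delta₁ w i θ (fun _ => T) n ≠ ∞) :
    splitSum w (i T) (i t) (excursionIndicator i T t) ≤ meanScale w i θ T t ^ 2 *
      (Real.exp ((delta₁ w i θ (fun _ => T) n).toReal / 2) *
        ∑ l ∈ Ioc (i T) (i t), delta₂Term w i θ T l) := by
  rw [splitSum, mul_sum, mul_sum]
  exact sum_le_sum fun l hl =>
    sq_weightRatio_mul_subsetAvg_sq_excursionIndicator_le hw hi hθ hθ0 hδ hl

end SecondMoment

/-! ### Positivity of the excursion weight -/

/-- The proportion of the total weight of `T_{i_t}` that is carried by the vertices whose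
ancestral line, restricted to the labels in `(i_T, i_t]`, is an excursion. -/
noncomputable def excursionWeight (w : ℕ → ℝ) (i : ℕ → ℕ) (T t : ℕ) (K : ℕ → ℕ) : ℝ :=
  vertexAvg w K (i t) fun s => excursionIndicator i T t (s ∩ Ioc (i T) (i t))

theorem le_treeHeight_of_excursionWeight_ne_zero {w : ℕ → ℝ} {i : ℕ → ℕ} {T t : ℕ} {K : ℕ → ℕ}
    (h : excursionWeight w i T t K ≠ 0) : t - T ≤ treeHeight K (i t) := by
  rw [excursionWeight, vertexAvg] at h
  obtain ⟨k, hk, hne⟩ := exists_ne_zero_of_sum_ne_zero h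
  have hu : IsExcursion i T t (ancestors K k ∩ Ioc (i T) (i t)) :=
    Set.mem_of_indicator_ne_zero (right_ne_zero_of_mul hne)
  calc t - T = #(ancestors K k ∩ Ioc (i T) (i t)) := hu.card_eq.symm
    _ ≤ #(ancestors K k) := card_le_card inter_subset_left
    _ = vertexHeight K k := card_ancestors K k
    _ ≤ treeHeight K (i t) := le_sup (f := vertexHeight K) hk

section Probability

variable {Ω : Type*} [MeasurableSpace Ω] {P : Measure Ω}

theorem measure_eq_zero_le_variance_div_sq [IsFiniteMeasure P] {Z : Ω → ℝ} (hZ : MemLp Z 2 P)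
    (hmean : 0 < ∫ ω, Z ω ∂P) :
    P {ω | Z ω = 0} ≤ ENNReal.ofReal (variance Z P / (∫ ω, Z ω ∂P) ^ 2) := by
  refine (measure_mono fun ω hω => ?_).trans (meas_ge_le_variance_div_sq hZ hmean)
  rw [Set.mem_ofPred] at hω ⊢
  rw [hω, zero_sub, abs_neg]
  exact le_abs_self _

theorem ae_eventually_notMem_of_eventually_le {s : ℕ → Set Ω} {b : ℕ → ℝ≥0∞}
    (hb : ∑' n, b n ≠ ∞) (h : ∀ᶠ n in atTop, P (s n) ≤ b n) :
    ∀ᵐ ω ∂P, ∀ᶠ n in atTop, ω ∉ s n := by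
  obtain ⟨N, hN⟩ := eventually_atTop.1 h
  have hsum : ∑' n, P (s (n + N)) ≠ ∞ :=
    ne_top_of_le_ne_top hb <| (ENNReal.tsum_le_tsum fun n => hN (n + N) (N.le_add_left n)).trans
      (ENNReal.tsum_comp_le_tsum_of_injective (add_left_injective N) b)
  filter_upwards [ae_eventually_notMem hsum] with ω hω
  rwa [← map_add_atTop_eq_nat N, eventually_map]

namespace IsWRT

variable [IsProbabilityMeasure P] {w : ℕ → ℝ} {K : ℕ → Ω → ℕ} {i : ℕ → ℕ} {θ : ℕ → ℝ}
  {T t : ℕ}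

theorem memLp_excursionWeight (hK : IsWRT P w K) (i : ℕ → ℕ) (T t : ℕ) (p : ℝ≥0∞) :
    MemLp (fun ω => excursionWeight w i T t (K · ω)) p P :=
  hK.memLp_vertexAvg _ _ p

theorem integral_excursionWeight (hw : ∀ n, 1 ≤ n → 0 ≤ w n) (hw1 : 0 < w 1) (hK : IsWRT P w K)
    (hi : StrictMono i) (hiT : 1 ≤ i T) (θ : ℕ → ℝ) (hTt : T ≤ t) :
    ∫ ω, excursionWeight w i T t (K · ω) ∂P =
      meanScale w i θ T t * E w i θ (fun _ => T) (i t) :=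
  (hK.integral_vertexAvg (fun _ hn => (totalWeight_pos hw hw1 hn).ne') hiT (hi.monotone hTt)
    (excursionIndicator i T t)).trans (subsetAvg_excursionIndicator hw hi θ hTt)

theorem variance_excursionWeight_le (hw : ∀ n, 1 ≤ n → 0 ≤ w n) (hw1 : 0 < w 1)
    (hK : IsWRT P w K) (hi : StrictMono i) (hiT : 1 ≤ i T) (hθ : MonotoneOn θ (Set.Ioi T))
    (hθ0 : ∀ r, T < r → 0 ≤ θ r) (hTt : T ≤ t) {n : ℕ}
    (hδ : delta₁ w i θ (fun _ => T) n ≠ ∞) :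
    variance (fun ω => excursionWeight w i T t (K · ω)) P ≤ meanScale w i θ T t ^ 2 *
      (Real.exp ((delta₁ w i θ (fun _ => T) n).toReal / 2) *
        ∑ l ∈ Ioc (i T) (i t), delta₂Term w i θ T l) := by
  have hW : ∀ n, 1 ≤ n → totalWeight w n ≠ 0 := fun _ hn => (totalWeight_pos hw hw1 hn).ne'
  have hiTt := hi.monotone hTt
  have hmean := hK.integral_vertexAvg hW hiT hiTt (excursionIndicator i T t)
  have hsq := hK.integral_vertexAvg_sq_le hW hiT hiTt (excursionIndicator i T t)
  rw [← hmean] at hsq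
  refine le_trans ?_ (splitSum_excursionIndicator_le hw hi hθ hθ0 hδ)
  rw [variance_eq_sub (hK.memLp_excursionWeight i T t 2)]
  exact sub_le_iff_le_add'.2 hsq

theorem measure_excursionWeight_eq_zero_le (hw : ∀ n, 1 ≤ n → 0 ≤ w n) (hw1 : 0 < w 1)
    (hK : IsWRT P w K) (hi : StrictMono i) (hiT : 1 ≤ i T) (hθ : MonotoneOn θ (Set.Ioi T))
    (hθ0 : ∀ r, T < r → 0 ≤ θ r) (hTt : T ≤ t) {n : ℕ}
    (hδ : delta₁ w i θ (fun _ => T) n ≠ ∞) (hE : E w i θ (fun _ => T) (i t) ≠ 0) :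
    P {ω | excursionWeight w i T t (K · ω) = 0} ≤
      ENNReal.ofReal (Real.exp ((delta₁ w i θ (fun _ => T) n).toReal / 2)) *
        (delta₂ w i θ (fun _ => T) n / ENNReal.ofReal (E w i θ (fun _ => T) (i t) ^ 2)) := by
  have hE_pos := (E_nonneg w i θ (fun _ => T) (i t)).lt_of_ne' hE
  have hG_pos := meanScale_pos hw i θ T t
  have hvar := hK.variance_excursionWeight_le hw hw1 hi hiT hθ hθ0 hTt hδ
  have hmean := hK.integral_excursionWeight hw hw1 hi hiT θ hTt
  have hsum := ofReal_sum_delta₂Term_le w i θ T n (i t)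
  have hzero := measure_eq_zero_le_variance_div_sq (hK.memLp_excursionWeight i T t 2)
    (hmean ▸ mul_pos hG_pos hE_pos)
  set D := Real.exp ((delta₁ w i θ (fun _ => T) n).toReal / 2)
  set S := ∑ l ∈ Ioc (i T) (i t), delta₂Term w i θ T l
  have hratio : variance (fun ω => excursionWeight w i T t (K · ω)) P /
      (meanScale w i θ T t * E w i θ (fun _ => T) (i t)) ^ 2 ≤
        D * (S / E w i θ (fun _ => T) (i t) ^ 2) := by
    rw [div_le_iff₀ (by positivity)]
    refine hvar.trans (le_of_eq ?_)
    field_simp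
  rw [hmean] at hzero
  refine hzero.trans ((ENNReal.ofReal_le_ofReal hratio).trans ?_)
  rw [ENNReal.ofReal_mul (Real.exp_pos _).le, ENNReal.ofReal_div_of_pos (by positivity)]
  gcongr

end IsWRT

end Probability

/-! ### The height for all large times -/

theorem treeHeight_mono (K : ℕ → ℕ) : Monotone (treeHeight K) := fun _ _ h =>
  sup_mono (Icc_subset_Icc_right h)

theorem delta₁_le_of_le (w : ℕ → ℝ) {i : ℕ → ℕ} (hi : Monotone i) (θ : ℕ → ℝ) {T : ℕ → ℕ}
    {m n : ℕ} (h : T m ≤ T n) : delta₁ w i θ T n ≤ delta₁ w i θ T m := by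
  have hsub : {l | i (T n) + 1 ≤ l} ⊆ {l | i (T m) + 1 ≤ l} := fun _ hl =>
    (Nat.add_le_add_right (hi h) 1).trans hl
  exact ENNReal.tsum_mono_subtype (fun l => ENNReal.ofReal
    (Real.exp (2 * θ (timeIndex i l)) * (w l ^ 2 / totalWeight w l ^ 2))) hsub

theorem eventually_timeIndex_sub_le_treeHeight {i T : ℕ → ℕ} (hi : StrictMono i)
    (hT : MonotoneOn T (Set.Ici 2)) {K : ℕ → ℕ}
    (h : ∀ᶠ t in atTop, t - T (i t) ≤ treeHeight K (i t)) :
    ∀ᶠ n in atTop, (timeIndex i n : ℤ) - (T n : ℤ) - 1 ≤ (treeHeight K n : ℤ) := by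
  obtain ⟨N, hN⟩ := eventually_atTop.1 h
  filter_upwards [eventually_gt_atTop (i (N + 2))] with n hn
  have hNn : N + 2 < timeIndex i n := (lt_timeIndex_iff hi).2 hn
  obtain ⟨t, ht⟩ : ∃ t, timeIndex i n = t + 1 := ⟨timeIndex i n - 1, by lia⟩
  have hit : i t < n := (lt_timeIndex_iff hi).1 (by lia)
  have htwo : 2 ≤ i t := le_trans (by lia) (hi.le_apply (x := t))
  have hTle : T (i t) ≤ T n := hT (Set.mem_Ici.2 htwo) (Set.mem_Ici.2 (by lia)) hit.le
  have hheight := (hN t (by lia)).trans (treeHeight_mono K hit.le)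
  lia

theorem IsWRT.ae_eventually_excursionWeight_ne_zero {Ω : Type*} [MeasurableSpace Ω]
    {P : Measure Ω} [IsProbabilityMeasure P] {w : ℕ → ℝ} (hw : ∀ n, 1 ≤ n → 0 ≤ w n)
    (hw1 : 0 < w 1) {K : ℕ → Ω → ℕ} (hK : IsWRT P w K) {i : ℕ → ℕ} (hi : StrictMono i)
    {T : ℕ → ℕ} (hTle : ∀ᶠ t in atTop, T (i t) ≤ t)
    (hTtop : Tendsto T atTop atTop) {θ : ℕ → ℝ} {r₀ : ℕ} (hθ : MonotoneOn θ (Set.Ici r₀))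
    (hθ0 : ∀ r, r₀ ≤ r → 0 ≤ θ r) (hE : ∀ᶠ t in atTop, E w i θ T (i t) ≠ 0)
    (hδ₁ : ∃ n, delta₁ w i θ T n ≠ ∞)
    (hδ₂ : ∑' t, delta₂ w i θ T (i (t + 1)) / ENNReal.ofReal (E w i θ T (i (t + 1)) ^ 2) ≠ ∞) :
    ∀ᵐ ω ∂P, ∀ᶠ t in atTop, excursionWeight w i (T (i t)) t (K · ω) ≠ 0 := by
  obtain ⟨m, hm⟩ := hδ₁
  set C := ENNReal.ofReal (Real.exp ((delta₁ w i θ T m).toReal / 2))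
  have hTi : Tendsto (fun t => T (i t)) atTop atTop := hTtop.comp hi.tendsto_atTop
  have hprob : ∀ᶠ t in atTop, P {ω | excursionWeight w i (T (i t)) t (K · ω) = 0} ≤
      C * (delta₂ w i θ T (i t) / ENNReal.ofReal (E w i θ T (i t) ^ 2)) := by
    filter_upwards [hTle, hE, hTi.eventually_ge_atTop (max r₀ (max (T m) 1))] with t hTt hEt hlarge
    have hr₀ : r₀ ≤ T (i t) := by lia
    have hiT : 1 ≤ i (T (i t)) := le_trans (by lia) hi.le_apply
    have hδ_le := delta₁_le_of_le w hi.monotone θ (show T m ≤ T (i t) by lia)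
    have hbound := hK.measure_excursionWeight_eq_zero_le hw hw1 hi hiT
      (hθ.mono fun r hr => hr₀.trans hr.le) (fun r hr => hθ0 r (hr₀.trans hr.le)) hTt
      (n := i t) (ne_top_of_le_ne_top hm hδ_le) hEt
    refine hbound.trans (mul_le_mul_left (ENNReal.ofReal_le_ofReal (Real.exp_le_exp.2 ?_)) _)
    exact div_le_div_of_nonneg_right (ENNReal.toReal_mono hm hδ_le) zero_le_two
  have hsum : ∑' t, C * (delta₂ w i θ T (i (t + 1)) /
      ENNReal.ofReal (E w i θ T (i (t + 1)) ^ 2)) ≠ ∞ := by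
    rw [ENNReal.tsum_mul_left]
    exact ENNReal.mul_ne_top ENNReal.ofReal_ne_top hδ₂
  filter_upwards [ae_eventually_notMem_of_eventually_le hsum
    ((tendsto_add_atTop_nat 1).eventually hprob)] with ω hω
  rwa [← map_add_atTop_eq_nat 1, eventually_map]

end WRT

theorem proposition4p3_general
    {Ω : Type*} [MeasurableSpace Ω] (P : Measure Ω) [IsProbabilityMeasure P]
    (w : ℕ → ℝ) (hw : ∀ n, 1 ≤ n → 0 ≤ w n) (hw1 : 0 < w 1)
    (K : ℕ → Ω → ℕ) (hK : WRT.IsWRT P w K)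
    (i : ℕ → ℕ) (hi : StrictMono i)
    (T : ℕ → ℕ) (hTmono : MonotoneOn T (Set.Ici 2))
    (hTlt : ∀ n, 2 ≤ n → T n < WRT.timeIndex i n) (hTtop : Tendsto T atTop atTop)
    (θ : ℕ → ℝ) (r₀ : ℕ) (hθmono : MonotoneOn θ (Set.Ici r₀)) (hθnonneg : ∀ r, r₀ ≤ r → 0 ≤ θ r)
    (hE : ∀ t, 1 ≤ t → WRT.E w i θ T (i t) ≠ 0)
    (hδ₁ : ∃ n, WRT.delta₁ w i θ T n ≠ ∞)
    (hδ₂ : ∑' t : ℕ,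
      WRT.delta₂ w i θ T (i (t + 1)) / ENNReal.ofReal (WRT.E w i θ T (i (t + 1)) ^ 2) < ∞) :
    ∀ᵐ ω ∂P, ∀ᶠ n in atTop,
      (WRT.timeIndex i n : ℤ) - (T n : ℤ) - 1 ≤ (WRT.treeHeight (fun m => K m ω) n : ℤ) := by
  have hTle : ∀ᶠ t in atTop, T (i t) ≤ t := by
    filter_upwards [eventually_ge_atTop 2] with t ht
    have hlt := hTlt (i t) (ht.trans hi.le_apply)
    rw [WRT.timeIndex_apply hi] at hlt
    exact hlt.le
  filter_upwards [hK.ae_eventually_excursionWeight_ne_zero hw hw1 hi hTle hTtop hθmono hθnonneg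
    (eventually_atTop.2 ⟨1, hE⟩) hδ₁ hδ₂.ne] with ω hω
  exact WRT.eventually_timeIndex_sub_le_treeHeight hi hTmono
    (hω.mono fun t ht => WRT.le_treeHeight_of_excursionWeight_ne_zero ht)

theorem proposition4p3
    {Ω : Type*} [MeasurableSpace Ω] (P : Measure Ω) [IsProbabilityMeasure P]
    -- the weights and the weighted recursive tree
    (w : ℕ → ℝ) (hw : ∀ n, 1 ≤ n → 0 ≤ w n) (hw1 : 0 < w 1)
    (K : ℕ → Ω → ℕ) (hK : WRT.IsWRT P w K)
    -- the time change
    (i : ℕ → ℕ) (hi : StrictMono i) (hi0 : i 0 = 1)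
    -- the sequence `(T(n))_{n ≥ 2}`
    (T : ℕ → ℕ) (hTmono : MonotoneOn T (Set.Ici 2))
    (hTlt : ∀ n, 2 ≤ n → T n < WRT.timeIndex i n) (hTtop : Tendsto T atTop atTop)
    -- the sequence `(θ_r)_{r ≥ 1}`
    (θ : ℕ → ℝ) (r₀ : ℕ) (hr₀ : 1 ≤ r₀) (hθmono : MonotoneOn θ (Set.Ici r₀))
    (hθnonneg : ∀ r, r₀ ≤ r → 0 ≤ θ r)
    -- the quotients in the second series are well defined, and both series converge
    (hE : ∀ t, 1 ≤ t → WRT.E w i θ T (i t) ≠ 0)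
    (hδ₁ : ∑' t : ℕ, WRT.delta₁ w i θ T (i (t + 1)) < ∞)
    (hδ₂ : ∑' t : ℕ,
      WRT.delta₂ w i θ T (i (t + 1)) / ENNReal.ofReal (WRT.E w i θ T (i (t + 1)) ^ 2) < ∞) :
    ∀ᵐ ω ∂P, ∀ᶠ n in atTop,
      (WRT.timeIndex i n : ℤ) - (T n : ℤ) - 1 ≤ (WRT.treeHeight (fun m => K m ω) n : ℤ) :=
  proposition4p3_general P w hw hw1 K hK i hi T hTmono hTlt hTtop θ r₀ hθmono hθnonneg hE
    ⟨i 1, ne_top_of_le_ne_top hδ₁.ne (ENNReal.le_tsum 0)⟩ hδ₂
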